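/- Let $\mathcal U,\mathcal Y$ be complex Hilbert spaces, $\mathbb C^+=\{z:\operatorname{Re}z>0\}$, and let $\varphi$ be a Schur function on $\mathbb C^+$: holomorphic, with values that are contractions from $\mathcal U$ to $\mathcal Y$. Put $\widetilde\varphi(\mu)=\varphi(\overline\mu)^*$. Let $\mathcal H_c$ be the Hilbert space of functions $\mathbb C^+\to\mathcal U$ with reproducing kernel $K_c$, where $$K_c(\mu,\lambda)=\frac{1-\varphi(\overline\mu)^*\varphi(\overline\lambda)}{\mu+\overline\lambda},$$ and let $e_c(\lambda):\mathcal H_c\to\mathcal U$ be evaluation at $\lambda$. Let $S_c:\mathcal H_c\times\mathcal U\supset\operatorname{dom}S_c\to\mathcal H_c\times\mathcal Y$ be the closed operator whose graph is the closed linear span of the pairs $\big((e_c(\overline\lambda)^*u,u),(\lambda e_c(\overline\lambda)^*u,\varphi(\lambda)u)\big)$, $\lambda\in\mathbb C^+$, $u\in\mathcal U$. Its main operator $A_c$ and observation operator $C_c$, with domain $\{x:(x,0)\in\operatorname{dom}S_c\}$, are given by $S_c(x,0)=(A_cx,C_cx)$; $A_c$ is densely defined, and $\mathbb C^+$ lies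 in the resolvent sets of $A_c$ and $A_c^*$. Fix $\beta\in\mathbb C^+$. * $\mathcal H_{c,1}=\operatorname{dom}A_c$ with norm $\|(\beta-A_c)x\|$ and $\mathcal H^d_{c,1}=\operatorname{dom}A_c^*$ with norm $\|(\overline\beta-A_c^*)x\|$; point evaluation is that of $\mathcal H_c$. * $\mathcal H_{c,-1}$ and $\mathcal H^d_{c,-1}$ are the completions of $\mathcal H_c$ in the norms $\|(\beta-A_c)^{-1}x\|$ and $\|(\overline\beta-A_c^*)^{-1}x\|$. The operator $A_c|_{\mathcal H_c}:\mathcal H_c\to\mathcal H_{c,-1}$ is the continuous extension of $A_c$. The control operator $B_c:\mathcal U\to\mathcal H_{c,-1}$ is the bounded operator such that the first component of $S_c(x,u)$ is $A_c|_{\mathcal H_c}x+B_cu$ for all $(x,u)\in\operatorname{dom}S_c$, and $B_c^*:\mathcal H^d_{c,1}\to\mathcal U$ is its adjoint in the duality between $\mathcal H_{c,-1}$ and $\mathcal H^d_{c,1}$ with pivot space $\mathcal H_c$. For $\alpha\in\mathbb C^+$, $(\alpha-A_c|_{\mathcal H_c})^{-1}:\mathcal H_{c,-1}\to\mathcal H_c$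 is the bounded inverse of $\alpha-A_c|_{\mathcal H_c}$. Put $\tau_{c,\beta}=C_c(\beta-A_c)^{-1}$. Functions defined by quotients with removable singularities are understood to be continued over these. The completion $\mathcal H^d_{c,-1}$ is isometrically identified, with $x\in\mathcal H_c$ corresponding to its class $[x]$, with the space of functions $x:\mathbb C^+\to\mathcal U$ such that $\mu\mapsto\frac{x(\mu)-x(\overline\beta)}{\overline\beta-\mu}$ is in $\mathcal H_c$, modulo the constants, with the $\mathcal H_c$-norm of this function as norm. On it we use the point evaluations $[x]\mapsto x(\mu)-x(\overline\beta)$. Consider the condition $$\text{for some (equivalently, for every) }\alpha\in\mathbb C^+:\qquad \mathcal H_c\cap\Big\{\mu\mapsto\frac{\widetilde\varphi(\mu)y}{\alpha+\mu}\ \Big|\ y\in\mathcal Y\Big\}=\{0\}.\tag{$*$}$$ If $(*)$ holds, then the completion $\mathcal H_{c,-1}$ is isometrically identified, with $x\in\mathcal H_c$ corresponding to $[x]$, with the space of functions $x:\mathbb C^+\to\mathcal U$ such that $\mu\mapsto\frac{x(\mu)+\widetilde\varphi(\mu)y}{\beta+\mu}$ is in $\mathcal H_c$ for some $y=y_x\in\mathcal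 Y$, modulo the functions $\widetilde\varphi(\cdot)y$, $y\in\mathcal Y$, with the $\mathcal H_c$-norm of $\frac{x+\widetilde\varphi y_x}{\beta+\cdot}$ as norm. On it we use the point evaluations $[x]\mapsto x(\mu)+\widetilde\varphi(\mu)y_x$. With these bounded point evaluations the four spaces have reproducing kernels $K_{c,1}$, $K^d_{c,1}$, $K^d_{c,-1}$ and, under $(*)$, $K_{c,-1}$. For all $\mu,\lambda\in\mathbb C^+$: $$\begin{aligned} K_c(\mu,\lambda)&=B_c^*(\mu-A_c^*)^{-1}(\overline\lambda-A_c|_{\mathcal H_c})^{-1}B_c,\\ K^d_{c,1}(\mu,\lambda)&=B_c^*(\mu-A_c^*)^{-1}(\overline\beta-A_c^*)^{-1}(\beta-A_c)^{-1}(\overline\lambda-A_c|_{\mathcal H_c})^{-1}B_c,\\ K^d_{c,-1}(\mu,\lambda)&=(\overline\beta-\mu)(\beta-\overline\lambda)\,B_c^*(\mu-A_c^*)^{-1}(\overline\lambda-A_c|_{\mathcal H_c})^{-1}B_c,\\ K_{c,1}(\mu,\lambda)&=B_c^*(\mu-A_c^*)^{-1}(\beta-A_c)^{-1}(\overline\beta-A_c^*)^{-1}(\overline\lambda-A_c|_{\mathcal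 H_c})^{-1}B_c, \end{aligned}$$ and, if $(*)$ holds, $$K_{c,-1}(\mu,\lambda)=(\beta+\mu)(\overline\beta+\overline\lambda)\,B_c^*(\mu-A_c^*)^{-1}(\overline\lambda-A_c|_{\mathcal H_c})^{-1}B_c.$$ Moreover, for all $\mu,\lambda\in\mathbb C^+$, $$\begin{aligned} K_c(\mu,\lambda)&=\frac{1-\varphi(\overline\mu)^*\varphi(\overline\lambda)}{\mu+\overline\lambda},\\ K^d_{c,1}(\mu,\lambda)&=\frac{K_c(\mu,\lambda)-K_c(\mu,\overline\beta)}{(\overline\beta-\mu)(\beta-\overline\lambda)}-\frac{K_c(\overline\beta,\lambda)-K_c(\overline\beta,\overline\beta)}{(\overline\beta-\mu)(\beta-\overline\lambda)},\\ K^d_{c,-1}(\mu,\lambda)&=(\overline\beta-\mu)(\beta-\overline\lambda)K_c(\mu,\lambda),\\ K_{c,1}(\mu,\lambda)u&=\frac{\kappa(\mu)-\varphi(\overline\mu)^*\,\tau_{c,\beta}\kappa}{\beta+\mu},\qquad \kappa(\mu)=\frac{K_c(\mu,\lambda)u-K_c(\overline\beta,\lambda)u}{\overline\beta-\mu},\quad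 u\in\mathcal U, \end{aligned}$$ where $\kappa\in\mathcal H_c$, and, if $(*)$ holds, $$K_{c,-1}(\mu,\lambda)=(\beta+\mu)(\overline\beta+\overline\lambda)K_c(\mu,\lambda).$$ Here $K^d_{c,1}$ is norm-continuous on $\mathbb C^+\times\mathbb C^+$, so that its formula, read for $\mu,\lambda\neq\overline\beta$, determines it everywhere. -/

import Mathlib

namespace DBR

open Complex ComplexConjugate Metric
open scoped InnerProductSpace NNReal

noncomputable section

section disk
variable {E : Type*} [NormedAddCommGroup E] [InnerProductSpace ℂ E] {ι : Type*}

/-- The Szegő kernel of the disc with center `c` and radius `ρ`. -/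
def szego (c : ℂ) (ρ : ℝ) (ζ p : ℂ) : ℂ := (ρ : ℂ) ^ 2 / ((ρ : ℂ) ^ 2 - (ζ - c) * conj (p - c))

theorem szego_denom_ne {c : ℂ} {ρ : ℝ} {ζ p : ℂ} (hζ : ζ ∈ closedBall c ρ) (hp : p ∈ ball c ρ) :
    (ρ : ℂ) ^ 2 - (ζ - c) * conj (p - c) ≠ 0 := by
  have hρ : 0 < ρ := pos_of_mem_ball hp
  intro h
  have h1 : ‖(ζ - c) * conj (p - c)‖ = ρ ^ 2 := by
    rw [← sub_eq_zero.mp h]; simp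
  rw [norm_mul, RCLike.norm_conj] at h1
  rw [mem_closedBall, dist_eq] at hζ
  rw [mem_ball, dist_eq] at hp
  nlinarith [norm_nonneg (ζ - c), norm_nonneg (p - c)]

theorem szego_diff {c : ℂ} {ρ : ℝ} {p : ℂ} (hp : p ∈ ball c ρ) :
    DifferentiableOn ℂ (fun ζ => szego c ρ ζ p) (closedBall c ρ) := by
  unfold szego
  refine DifferentiableOn.div (by fun_prop) (by fun_prop) fun ζ hζ => szego_denom_ne hζ hp

theorem szego_conj {c : ℂ} {ρ : ℝ} {ζ p : ℂ} (hζ : ζ ∈ sphere c ρ) (hp : p ∈ ball c ρ) :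
    conj (szego c ρ ζ p) = (ζ - c) / (ζ - p) := by
  have hρ : 0 < ρ := pos_of_mem_ball hp
  have h0 := szego_denom_ne (sphere_subset_closedBall hζ) hp
  have h1 : (ζ - c) * conj (ζ - c) = (ρ : ℂ) ^ 2 := by
    rw [mul_conj, normSq_eq_norm_sq]
    rw [mem_sphere, dist_eq] at hζ
    rw [hζ]; push_cast; ring
  have h2 : ζ - p ≠ 0 := by
    intro h
    rw [sub_eq_zero.mp h] at hζ
    simp only [mem_sphere, mem_ball] at hζ hp
    linarith
  unfold szego
  have h5 : (ρ : ℂ) ^ 2 - conj (ζ - c) * (p - c) ≠ 0 := by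
    have := (map_ne_zero (starRingEnd ℂ)).mpr h0
    simpa using this
  have : conj ((ρ : ℂ) ^ 2 / ((ρ : ℂ) ^ 2 - (ζ - c) * conj (p - c)))
      = (ρ : ℂ) ^ 2 / ((ρ : ℂ) ^ 2 - conj (ζ - c) * (p - c)) := by simp
  rw [this, div_eq_div_iff h5 h2]
  linear_combination (p - c) * h1

theorem circle_repro {c : ℂ} {ρ : ℝ} (hρ : 0 < ρ) (s : Finset ι) (p : ι → ℂ)
    (hp : ∀ i, p i ∈ ball c ρ) (v : ι → E) (F : ℂ → E)
    (hF : ∀ i, DifferentiableOn ℂ (fun ζ => ⟪v i, F ζ⟫_ℂ) (closedBall c ρ)) :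
    CircleIntegrable (fun ζ => ⟪∑ i ∈ s, szego c ρ ζ (p i) • v i, F ζ⟫_ℂ) c ρ ∧
    Real.circleAverage (fun ζ => ⟪∑ i ∈ s, szego c ρ ζ (p i) • v i, F ζ⟫_ℂ) c ρ
      = ∑ i ∈ s, ⟪v i, F (p i)⟫_ℂ := by
  have habs : |ρ| = ρ := abs_of_pos hρ
  have hEq : Set.EqOn (fun ζ => ⟪∑ i ∈ s, szego c ρ ζ (p i) • v i, F ζ⟫_ℂ)
      (fun ζ => ∑ i ∈ s, ((ζ - c) / (ζ - p i)) • ⟪v i, F ζ⟫_ℂ) (sphere c |ρ|) := by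
    intro ζ hζ
    rw [habs] at hζ
    simp only [sum_inner, inner_smul_left]
    refine Finset.sum_congr rfl fun i _ => ?_
    rw [szego_conj hζ (hp i), smul_eq_mul]
  have hint : ∀ i, CircleIntegrable (fun ζ => ((ζ - c) / (ζ - p i)) • ⟪v i, F ζ⟫_ℂ) c ρ := by
    intro i
    refine ContinuousOn.circleIntegrable hρ.le ?_
    refine ContinuousOn.smul (ContinuousOn.div (f := fun ζ => ζ - c) (g := fun ζ => ζ - p i)
      (by fun_prop) (by fun_prop) ?_) ((hF i).continuousOn.mono sphere_subset_closedBall)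
    intro ζ hζ h
    rw [sub_eq_zero.mp h] at hζ
    have := hp i
    simp only [mem_sphere, mem_ball] at hζ this
    linarith
  constructor
  · refine (circleIntegrable_congr ?_).mpr (CircleIntegrable.fun_sum s fun i _ => hint i)
    exact hEq
  · rw [Real.circleAverage_congr_sphere hEq, Real.circleAverage_fun_sum fun i _ => hint i]
    refine Finset.sum_congr rfl fun i _ => ?_
    refine DiffContOnCl.circleAverage_smul_div (f := fun ζ => ⟪v i, F ζ⟫_ℂ) ?_ (by rw [habs]; exact hp i)
    rw [habs]
    exact DifferentiableOn.diffContOnCl (by rw [closure_ball _ hρ.ne']; exact hF i)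

variable {Y : Type*} [NormedAddCommGroup Y] [InnerProductSpace ℂ Y]

theorem disk_pos {c : ℂ} {ρ : ℝ} (hρ : 0 < ρ) (s : Finset ι) (p : ι → ℂ)
    (hp : ∀ i, p i ∈ ball c ρ) (ψ : ℂ → Y →L[ℂ] E)
    (hψ : ∀ (u : E) (y : Y), DifferentiableOn ℂ (fun ζ => ⟪u, ψ ζ y⟫_ℂ) (closedBall c ρ))
    (hψ1 : ∀ ζ ∈ closedBall c ρ, ‖ψ ζ‖ ≤ 1) (w : ι → E) (y : ι → Y)
    (hy : ∀ i z, ⟪y i, z⟫_ℂ = ⟪w i, ψ (p i) z⟫_ℂ) :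
    0 ≤ re (∑ i ∈ s, ∑ j ∈ s, szego c ρ (p i) (p j) * (⟪w i, w j⟫_ℂ - ⟪y i, y j⟫_ℂ)) := by
  set f : ℂ → E := fun ζ => ∑ i ∈ s, szego c ρ ζ (p i) • w i with hf
  set g : ℂ → Y := fun ζ => ∑ i ∈ s, szego c ρ ζ (p i) • y i with hg
  have hfd : ∀ u : E, DifferentiableOn ℂ (fun ζ => ⟪u, f ζ⟫_ℂ) (closedBall c ρ) := by
    intro u
    simp only [hf, inner_sum, inner_smul_right]
    exact DifferentiableOn.fun_sum fun i _ => (szego_diff (hp i)).mul_const _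
  have hgd : ∀ u : Y, DifferentiableOn ℂ (fun ζ => ⟪u, g ζ⟫_ℂ) (closedBall c ρ) := by
    intro u
    simp only [hg, inner_sum, inner_smul_right]
    exact DifferentiableOn.fun_sum fun i _ => (szego_diff (hp i)).mul_const _
  have hpd : ∀ u : E, DifferentiableOn ℂ (fun ζ => ⟪u, ψ ζ (g ζ)⟫_ℂ) (closedBall c ρ) := by
    intro u
    simp only [hg, map_sum, map_smul, inner_sum, inner_smul_right]
    exact DifferentiableOn.fun_sum fun i _ => (szego_diff (hp i)).mul (hψ _ _)
  obtain ⟨i1, e1⟩ := circle_repro hρ s p hp w f fun i => hfd _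
  obtain ⟨i2, e2⟩ := circle_repro hρ s p hp y g fun i => hgd _
  obtain ⟨i3, e3⟩ := circle_repro hρ s p hp w (fun ζ => ψ ζ (g ζ)) fun i => hpd _
  have e23 : ∑ i ∈ s, ⟪w i, ψ (p i) (g (p i))⟫_ℂ = ∑ i ∈ s, ⟪y i, g (p i)⟫_ℂ :=
    Finset.sum_congr rfl fun i _ => (hy i _).symm
  rw [e23, ← e2] at e3
  have reint : ∀ {h : ℂ → ℂ}, CircleIntegrable h c ρ → CircleIntegrable (fun ζ => re (h ζ)) c ρ :=
    fun {h} hh => ⟨hh.1.re, hh.2.re⟩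
  have recomm : ∀ {h : ℂ → ℂ}, CircleIntegrable h c ρ →
      Real.circleAverage (fun ζ => re (h ζ)) c ρ = re (Real.circleAverage h c ρ) := by
    intro h hh
    exact reCLM.circleAverage_comp_comm hh
  have key : Real.circleAverage (fun ζ => re ⟪f ζ, ψ ζ (g ζ)⟫_ℂ + re ⟪f ζ, ψ ζ (g ζ)⟫_ℂ) c ρ ≤
      Real.circleAverage (fun ζ => re ⟪f ζ, f ζ⟫_ℂ + re ⟪g ζ, g ζ⟫_ℂ) c ρ := by
    refine Real.circleAverage_mono ((reint i3).add (reint i3)) ((reint i1).add (reint i2)) ?_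
    intro ζ hζ
    rw [abs_of_pos hρ] at hζ
    have a1 : re ⟪f ζ, ψ ζ (g ζ)⟫_ℂ ≤ ‖f ζ‖ * ‖ψ ζ (g ζ)‖ := re_inner_le_norm (𝕜 := ℂ) _ _
    have a2 : ‖ψ ζ (g ζ)‖ ≤ ‖g ζ‖ := by
      have := (ψ ζ).le_of_opNorm_le (hψ1 ζ (sphere_subset_closedBall hζ)) (g ζ)
      simpa using this
    have a3 : re ⟪f ζ, f ζ⟫_ℂ = ‖f ζ‖ ^ 2 := (norm_sq_eq_re_inner (𝕜 := ℂ) _).symm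
    have a4 : re ⟪g ζ, g ζ⟫_ℂ = ‖g ζ‖ ^ 2 := (norm_sq_eq_re_inner (𝕜 := ℂ) _).symm
    simp only [a3, a4]
    nlinarith [norm_nonneg (f ζ), norm_nonneg (g ζ), sq_nonneg (‖f ζ‖ - ‖g ζ‖),
      mul_le_mul_of_nonneg_left a2 (norm_nonneg (f ζ))]
  rw [Real.circleAverage_fun_add (reint i3) (reint i3), Real.circleAverage_fun_add (reint i1) (reint i2),
    recomm i3, recomm i1, recomm i2, e3, e1, e2] at key
  have : ∑ i ∈ s, ∑ j ∈ s, szego c ρ (p i) (p j) * (⟪w i, w j⟫_ℂ - ⟪y i, y j⟫_ℂ)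
      = ∑ i ∈ s, ⟪w i, f (p i)⟫_ℂ - ∑ i ∈ s, ⟪y i, g (p i)⟫_ℂ := by
    rw [← Finset.sum_sub_distrib]
    refine Finset.sum_congr rfl fun i _ => ?_
    simp only [hf, hg, inner_sum, inner_smul_right, mul_sub, Finset.sum_sub_distrib]
  rw [this, sub_re]
  linarith
end disk

section schur

/-- The open right half-plane. -/
abbrev CPlus := {z : ℂ // 0 < z.re}

/-- Complex conjugation as a map of the right half-plane. -/
def CPlus.conj (z : CPlus) : CPlus := ⟨starRingEnd ℂ z, by simpa using z.2⟩

@[simp] theorem CPlus.coe_conj (z : CPlus) : (z.conj : ℂ) = starRingEnd ℂ (z : ℂ) := rfl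

@[simp] theorem CPlus.conj_conj (z : CPlus) : z.conj.conj = z := Subtype.ext (by simp)

theorem CPlus.add_ne (z w : CPlus) : (z : ℂ) + w ≠ 0 := by
  intro h
  have := congrArg Complex.re h
  simp only [add_re, zero_re] at this
  linarith [z.2, w.2]

/-- The Schur class of the right half-plane: holomorphic functions on the right half-plane whose
values are contractions from `U` to `Y`. (Values outside the half-plane are irrelevant.) -/
structure SchurFunction (U Y : Type*) [NormedAddCommGroup U] [InnerProductSpace ℂ U]
    [NormedAddCommGroup Y] [InnerProductSpace ℂ Y] where
  toFun : ℂ → U →L[ℂ] Y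
  holomorphic : DifferentiableOn ℂ toFun {z | 0 < z.re}
  contractive : ∀ z : ℂ, 0 < z.re → ‖toFun z‖ ≤ 1

variable {U Y : Type*} [NormedAddCommGroup U] [InnerProductSpace ℂ U] [CompleteSpace U]
  [NormedAddCommGroup Y] [InnerProductSpace ℂ Y] [CompleteSpace Y]

/-- The function `φ̃(μ) = φ(μ̄)^*`. -/
def tilde (φ : SchurFunction U Y) (μ : CPlus) : Y →L[ℂ] U :=
  ContinuousLinearMap.adjoint (φ.toFun μ.conj)

/-- The kernel `K_c(μ, λ) = (1 - φ(μ̄)^* φ(λ̄)) / (μ + λ̄)`. -/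
def Kc (φ : SchurFunction U Y) : Matrix CPlus CPlus (U →L[ℂ] U) :=
  .of fun μ l => ((μ : ℂ) + conj (l : ℂ))⁻¹ •
    (1 - ContinuousLinearMap.adjoint (φ.toFun μ.conj) ∘L φ.toFun l.conj)

theorem Kc_apply (φ : SchurFunction U Y) (μ l : CPlus) (u : U) :
    Kc φ μ l u = ((μ : ℂ) + conj (l : ℂ))⁻¹ • (u - tilde φ μ (φ.toFun l.conj u)) := rfl

theorem Kc_inner (φ : SchurFunction U Y) (μ l : CPlus) (u v : U) :
    ⟪Kc φ μ l u, v⟫_ℂ = ((l : ℂ) + conj (μ : ℂ))⁻¹ *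
      (⟪u, v⟫_ℂ - ⟪φ.toFun l.conj u, φ.toFun μ.conj v⟫_ℂ) := by
  rw [Kc_apply, inner_smul_left, inner_sub_left, tilde, ContinuousLinearMap.adjoint_inner_left]
  simp [add_comm]

theorem Kc_isHermitian (φ : SchurFunction U Y) : (Kc φ).IsHermitian := by
  ext μ l u
  refine ext_inner_right ℂ fun v => ?_
  rw [Matrix.conjTranspose_apply, ContinuousLinearMap.star_eq_adjoint,
    ContinuousLinearMap.adjoint_inner_left, Kc_inner, ← inner_conj_symm, Kc_inner]
  simp [add_comm]

theorem szego_tendsto (p q : ℂ) (h : p + conj q ≠ 0) :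
    Filter.Tendsto (fun n : ℕ => ((n : ℂ) + 1)⁻¹ *
      szego (((n : ℂ) + 1) + ((n : ℂ) + 1)⁻¹) ((n : ℝ) + 1) p q) Filter.atTop
      (nhds (p + conj q)⁻¹) := by
  have h0 : Filter.Tendsto (fun n : ℕ => ((n : ℂ) + 1)⁻¹) Filter.atTop (nhds 0) := by
    simpa using tendsto_one_div_add_atTop_nhds_zero_nat (𝕜 := ℂ)
  have key : ∀ n : ℕ, ((n : ℂ) + 1)⁻¹ *
      szego (((n : ℂ) + 1) + ((n : ℂ) + 1)⁻¹) ((n : ℝ) + 1) p q =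
      ((p + conj q) * (1 + ((n : ℂ) + 1)⁻¹ ^ 2) - 2 * ((n : ℂ) + 1)⁻¹ - ((n : ℂ) + 1)⁻¹ ^ 3
        - p * conj q * ((n : ℂ) + 1)⁻¹)⁻¹ := by
    intro n
    have hn : (n : ℂ) + 1 ≠ 0 := by exact_mod_cast Nat.succ_ne_zero n
    unfold szego
    have hc : conj (q - ((n : ℂ) + 1 + ((n : ℂ) + 1)⁻¹)) = conj q - ((n : ℂ) + 1 + ((n : ℂ) + 1)⁻¹) := by
      simp
    rw [hc]
    push_cast
    rw [div_eq_mul_inv, ← mul_assoc]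
    have e : ((n : ℂ) + 1)⁻¹ * ((n : ℂ) + 1) ^ 2 = ((n : ℂ) + 1) := by field_simp
    rw [e]
    conv_lhs => rw [← inv_inv ((n : ℂ) + 1), ← mul_inv]
    congr 1
    simp only [inv_inv]
    field_simp
    ring
  simp_rw [key]
  refine Filter.Tendsto.inv₀ ?_ h
  have := (((h0.pow 2).const_add 1).const_mul (p + conj q)).sub (h0.const_mul 2) |>.sub (h0.pow 3)
    |>.sub (h0.const_mul (p * conj q))
  simpa using this

theorem disc_facts (z : CPlus) : ∀ᶠ n : ℕ in Filter.atTop,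
    (z : ℂ) ∈ ball ((n : ℂ) + 1 + ((n : ℂ) + 1)⁻¹) ((n : ℝ) + 1) := by
  obtain ⟨N, hN⟩ := exists_nat_gt ((‖(z : ℂ)‖ ^ 2 + 3) / z.1.re)
  filter_upwards [Filter.eventually_ge_atTop N] with n hn
  have hz := z.2
  have hn1 : (1 : ℝ) ≤ (n : ℝ) + 1 := by linarith [(Nat.cast_nonneg n : (0 : ℝ) ≤ n)]
  have hn0 : (0 : ℝ) < (n : ℝ) + 1 := by linarith
  have h1 : ‖(z : ℂ)‖ ^ 2 + 3 < z.1.re * ((n : ℝ) + 1) := by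
    rw [div_lt_iff₀ hz] at hN
    have : (N : ℝ) ≤ n := by exact_mod_cast hn
    nlinarith
  have hi1 : ((n : ℝ) + 1)⁻¹ ≤ 1 := inv_le_one_of_one_le₀ hn1
  have hi0 : 0 < ((n : ℝ) + 1)⁻¹ := inv_pos.mpr hn0
  have hmul : ((n : ℝ) + 1) * ((n : ℝ) + 1)⁻¹ = 1 := mul_inv_cancel₀ hn0.ne'
  set a : ℝ := (n : ℝ) + 1
  have hc : ((n : ℂ) + 1 + ((n : ℂ) + 1)⁻¹) = ((a + a⁻¹ : ℝ) : ℂ) := by simp [a]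
  rw [hc, mem_ball, dist_eq]
  refine lt_of_pow_lt_pow_left₀ 2 hn0.le ?_
  rw [← normSq_eq_norm_sq, normSq_apply] at h1 ⊢
  simp only [sub_re, sub_im, ofReal_re, ofReal_im]
  nlinarith [mul_pos hz hi0, sq_nonneg z.1.re, mul_pos hz hn0]

theorem Kc_posSemidef (φ : SchurFunction U Y) : (Kc φ).PosSemidef := by
  refine ((RKHS.posSemidef_tfae (K := Kc φ)).out 0 2).2 (And.intro (Kc_isHermitian φ) fun w => ?_)
  simp only [Finsupp.sum, Kc_inner]
  let G : ℕ → ℂ := fun n => ∑ x ∈ w.support, ∑ y ∈ w.support,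
    (((n : ℂ) + 1)⁻¹ * szego (((n : ℂ) + 1) + ((n : ℂ) + 1)⁻¹) ((n : ℝ) + 1) x y) *
      (⟪w x, w y⟫_ℂ - ⟪φ.toFun x.conj (w x), φ.toFun y.conj (w y)⟫_ℂ)
  have hlim : Filter.Tendsto G Filter.atTop (nhds (∑ x ∈ w.support, ∑ y ∈ w.support,
      ((x : ℂ) + conj (y : ℂ))⁻¹ *
      (⟪w x, w y⟫_ℂ - ⟪φ.toFun x.conj (w x), φ.toFun y.conj (w y)⟫_ℂ))) := by
    refine tendsto_finsetSum _ fun x _ => tendsto_finsetSum _ fun y _ => ?_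
    exact (szego_tendsto _ _ (CPlus.add_ne x y.conj)).mul_const _
  refine ge_of_tendsto ((continuous_re.tendsto _).comp hlim) ?_
  have hev : ∀ᶠ n : ℕ in Filter.atTop, ∀ z ∈ w.support,
      (z : ℂ) ∈ ball ((n : ℂ) + 1 + ((n : ℂ) + 1)⁻¹) ((n : ℝ) + 1) :=
    (Filter.eventually_all_finset _).mpr fun z _ => disc_facts z
  filter_upwards [hev] with n hn
  have hn0 : (0 : ℝ) < (n : ℝ) + 1 := by linarith [(Nat.cast_nonneg n : (0 : ℝ) ≤ n)]
  have hsub : ∀ ζ ∈ closedBall ((n : ℂ) + 1 + ((n : ℂ) + 1)⁻¹) ((n : ℝ) + 1), 0 < ζ.re := by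
    intro ζ hζ
    rw [mem_closedBall, dist_eq] at hζ
    have h1 := (abs_le.mp ((abs_re_le_norm _).trans hζ)).1
    have hc : ((n : ℂ) + 1 + ((n : ℂ) + 1)⁻¹) = (((n : ℝ) + 1 + ((n : ℝ) + 1)⁻¹ : ℝ) : ℂ) := by simp
    rw [hc, sub_re, ofReal_re] at h1
    linarith [inv_pos.mpr hn0]
  have hmain := disk_pos (E := U) (Y := Y) hn0 w.support.attach (fun z => (z.1 : ℂ))
    (fun z => hn z.1 z.2) (fun ζ => ContinuousLinearMap.adjoint (φ.toFun (conj ζ)))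
    (fun u y ζ hζ => by
      have hd : DifferentiableAt ℂ (fun z => ⟪y, φ.toFun z u⟫_ℂ) (conj ζ) := by
        have h1 : DifferentiableAt ℂ φ.toFun (conj ζ) :=
          φ.holomorphic.differentiableAt
            ((isOpen_lt continuous_const continuous_re).mem_nhds (by simpa using hsub ζ hζ))
        have h2 : DifferentiableAt ℂ (fun z => φ.toFun z u) (conj ζ) :=
          h1.clm_apply (differentiableAt_const u)
        exact ((innerSL ℂ y).differentiableAt).comp _ h2
      have h3 := hd.conj_conj
      rw [RCLike.conj_conj] at h3
      have h4 : (fun ζ => ⟪u, ContinuousLinearMap.adjoint (φ.toFun (conj ζ)) y⟫_ℂ) =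
          conj ∘ (fun z => ⟪y, φ.toFun z u⟫_ℂ) ∘ conj := by
        funext z
        rw [ContinuousLinearMap.adjoint_inner_right]
        simp only [Function.comp_apply, inner_conj_symm]
      rw [← h4] at h3
      exact DifferentiableAt.differentiableWithinAt h3)
    (fun ζ hζ => by
      rw [LinearIsometryEquiv.norm_map]
      exact φ.contractive _ (by simpa using hsub ζ hζ))
    (fun z => w z.1) (fun z => φ.toFun (CPlus.conj z.1) (w z.1))
    (fun z v => by rw [ContinuousLinearMap.adjoint_inner_right]; rfl)
  have hG : G n = (((((n : ℝ) + 1)⁻¹ : ℝ)) : ℂ) * ∑ i ∈ w.support.attach, ∑ j ∈ w.support.attach,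
      szego ((n : ℂ) + 1 + ((n : ℂ) + 1)⁻¹) ((n : ℝ) + 1) (i.1 : ℂ) (j.1 : ℂ) *
      (⟪w i.1, w j.1⟫_ℂ - ⟪φ.toFun (CPlus.conj i.1) (w i.1), φ.toFun (CPlus.conj j.1) (w j.1)⟫_ℂ) := by
    simp only [G]
    rw [← Finset.sum_attach, Finset.mul_sum]
    refine Finset.sum_congr rfl fun i _ => ?_
    rw [← Finset.sum_attach, Finset.mul_sum]
    refine Finset.sum_congr rfl fun j _ => ?_
    push_cast
    ring
  show 0 ≤ (G n).re
  rw [hG, re_ofReal_mul]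
  exact mul_nonneg (inv_pos.mpr hn0).le hmain

end schur

section rigging

variable {X : Type*} [NormedAddCommGroup X] [InnerProductSpace ℂ X]

/-- The operator `α - A`, defined on the domain of `A`. -/
def shift (A : X →ₗ.[ℂ] X) (α : ℂ) : A.domain →ₗ[ℂ] X := α • A.domain.subtype - A.toFun

theorem shift_apply (A : X →ₗ.[ℂ] X) (α : ℂ) (x : A.domain) : shift A α x = α • (x : X) - A x := rfl

/-- `α` lies in the resolvent set of `A`: the operator `α - A` maps the domain of `A` one-to-one
onto `X`, and its inverse is bounded. -/
class InResolventSet (A : X →ₗ.[ℂ] X) (α : ℂ) : Prop where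
  bijective : Function.Bijective (shift A α)
  bounded : ∃ C : ℝ, ∀ x : A.domain, ‖(x : X)‖ ≤ C * ‖shift A α x‖

/-- The inverse `(α - A)⁻¹`, as a map from `X` onto the domain of `A`. -/
def resDom (A : X →ₗ.[ℂ] X) (α : ℂ) [h : InResolventSet A α] : X →ₗ[ℂ] A.domain :=
  (LinearEquiv.ofBijective (shift A α) h.bijective).symm.toLinearMap

@[simp] theorem shift_resDom (A : X →ₗ.[ℂ] X) (α : ℂ) [h : InResolventSet A α] (x : X) :
    shift A α (resDom A α x) = x :=
  (LinearEquiv.ofBijective (shift A α) h.bijective).apply_symm_apply x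

@[simp] theorem resDom_shift (A : X →ₗ.[ℂ] X) (α : ℂ) [h : InResolventSet A α] (x : A.domain) :
    resDom A α (shift A α x) = x :=
  (LinearEquiv.ofBijective (shift A α) h.bijective).symm_apply_apply x

/-- The resolvent `(α - A)⁻¹`, as a bounded operator on `X`. -/
def resOp (A : X →ₗ.[ℂ] X) (α : ℂ) [h : InResolventSet A α] : X →L[ℂ] X :=
  LinearMap.mkContinuousOfExistsBound (A.domain.subtype ∘ₗ resDom A α) <| by
    obtain ⟨C, hC⟩ := h.bounded
    exact ⟨C, fun x => by simpa using hC (resDom A α x)⟩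

theorem resOp_apply (A : X →ₗ.[ℂ] X) (α : ℂ) [InResolventSet A α] (x : X) :
    resOp A α x = resDom A α x := rfl

theorem resOp_injective (A : X →ₗ.[ℂ] X) (α : ℂ) [InResolventSet A α] :
    Function.Injective (resOp A α) := by
  intro x y hxy
  rw [resOp_apply, resOp_apply] at hxy
  rw [← shift_resDom A α x, Subtype.ext hxy, shift_resDom]

/-- The rigged space `X₁`: the domain of `A` with the inner product
`⟨x, y⟩₁ = ⟨(β - A) x, (β - A) y⟩`. -/
def RigOne (A : X →ₗ.[ℂ] X) (_β : ℂ) : Type _ := A.domain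

section RigOne
variable (A : X →ₗ.[ℂ] X) (β : ℂ)

instance : AddCommGroup (RigOne A β) := inferInstanceAs (AddCommGroup A.domain)
instance : Module ℂ (RigOne A β) := inferInstanceAs (Module ℂ A.domain)

/-- The operator `β - A` on `X₁`. -/
def RigOne.shift : RigOne A β →ₗ[ℂ] X := DBR.shift A β

instance [h : InResolventSet A β] : NormedAddCommGroup (RigOne A β) :=
  NormedAddCommGroup.induced (RigOne A β) X (RigOne.shift A β) h.bijective.1

instance [InResolventSet A β] : InnerProductSpace ℂ (RigOne A β) :=
  InnerProductSpace.induced (RigOne.shift A β)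

theorem RigOne.norm_eq [InResolventSet A β] (x : RigOne A β) : ‖x‖ = ‖RigOne.shift A β x‖ := rfl

instance [h : InResolventSet A β] [CompleteSpace X] : CompleteSpace (RigOne A β) := by
  have h1 : Isometry (RigOne.shift A β) :=
    AddMonoidHomClass.isometry_of_norm _ fun x => (RigOne.norm_eq A β x).symm
  have h2 : Function.Surjective (RigOne.shift A β) := h.bijective.2
  exact (h1.isUniformInducing.completeSpace_congr h2).mpr inferInstance

/-- The inclusion of `X₁` into `X`. -/
def RigOne.incl [h : InResolventSet A β] : RigOne A β →L[ℂ] X :=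
  LinearMap.mkContinuousOfExistsBound (A.domain.subtype : A.domain →ₗ[ℂ] X) h.bounded

theorem RigOne.incl_injective [InResolventSet A β] : Function.Injective (RigOne.incl A β) :=
  Subtype.val_injective

end RigOne

/-- The space `X` with the norm `‖x‖₋₁ = ‖(β - A)⁻¹ x‖`. -/
def PreExt (_A : X →ₗ.[ℂ] X) (_β : ℂ) : Type _ := X

section Ext
variable (A : X →ₗ.[ℂ] X) (β : ℂ)

instance : AddCommGroup (PreExt A β) := inferInstanceAs (AddCommGroup X)
instance : Module ℂ (PreExt A β) := inferInstanceAs (Module ℂ X)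

/-- The operator `(β - A)⁻¹` on `X`, where `X` carries the norm `‖x‖₋₁ = ‖(β - A)⁻¹ x‖`. -/
def PreExt.res [InResolventSet A β] : PreExt A β →ₗ[ℂ] X := (resOp A β).toLinearMap

instance [InResolventSet A β] : NormedAddCommGroup (PreExt A β) :=
  NormedAddCommGroup.induced (PreExt A β) X (PreExt.res A β) (resOp_injective A β)

instance [InResolventSet A β] : InnerProductSpace ℂ (PreExt A β) :=
  InnerProductSpace.induced (PreExt.res A β)

theorem PreExt.norm_eq [InResolventSet A β] (x : PreExt A β) : ‖x‖ = ‖PreExt.res A β x‖ := rfl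

/-- The rigged (extrapolation) space `X₋₁`: the completion of `X` in the norm
`‖x‖₋₁ = ‖(β - A)⁻¹ x‖`. -/
abbrev Ext [InResolventSet A β] := UniformSpace.Completion (PreExt A β)

/-- The identity map from `X` to `X` with the norm `‖·‖₋₁`. -/
def PreExt.of : X →ₗ[ℂ] PreExt A β := LinearMap.id

/-- The embedding of `X` into `X₋₁`. -/
def Ext.emb [InResolventSet A β] : X →L[ℂ] Ext A β :=
  LinearMap.mkContinuous
    ((UniformSpace.Completion.toComplL (𝕜 := ℂ) (E := PreExt A β)).toLinearMap ∘ₗ PreExt.of A β)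
    ‖resOp A β‖ fun x => by
      refine (UniformSpace.Completion.norm_coe (PreExt.of A β x)).trans_le ?_
      exact (resOp A β).le_opNorm x

theorem Ext.emb_apply [InResolventSet A β] (x : X) :
    Ext.emb A β x = ((PreExt.of A β x : PreExt A β) : Ext A β) := rfl

theorem Ext.norm_emb [InResolventSet A β] (x : X) : ‖Ext.emb A β x‖ = ‖resOp A β x‖ :=
  UniformSpace.Completion.norm_coe (PreExt.of A β x)

theorem Ext.denseRange_emb [InResolventSet A β] : DenseRange (Ext.emb A β) :=
  UniformSpace.Completion.denseRange_coe (α := PreExt A β)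

variable [CompleteSpace X]

set_option linter.unusedSectionVars false

/-- The extension of `(β - A)⁻¹` to a (unitary) operator from `X₋₁` to `X`. -/
def Ext.res [InResolventSet A β] : Ext A β →L[ℂ] X :=
  LinearMap.extendOfNorm (resOp A β).toLinearMap (Ext.emb A β).toLinearMap

@[simp] theorem Ext.res_emb [InResolventSet A β] (x : X) :
    Ext.res A β (Ext.emb A β x) = resOp A β x :=
  LinearMap.extendOfNorm_eq (f := (resOp A β).toLinearMap) (e := (Ext.emb A β).toLinearMap)
    (Ext.denseRange_emb A β) ⟨1, fun x => by simp [Ext.norm_emb]⟩ x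

/-- The extension of `A` to a bounded operator from `X` to `X₋₁`. -/
def Ext.op [InResolventSet A β] : X →L[ℂ] Ext A β :=
  LinearMap.extendOfNorm ((Ext.emb A β).toLinearMap ∘ₗ A.toFun) A.domain.subtype

/-- `Ext.op` extends `A`. -/
theorem Ext.op_apply [InResolventSet A β] (hA : Dense (A.domain : Set X)) (x : A.domain) :
    Ext.op A β x = Ext.emb A β (A x) := by
  refine LinearMap.extendOfNorm_eq (f := (Ext.emb A β).toLinearMap ∘ₗ A.toFun)
    (e := A.domain.subtype) (by simpa [DenseRange] using hA) ⟨‖β‖ * ‖resOp A β‖ + 1, fun x => ?_⟩ x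
  have h1 : resOp A β (A x) = β • resOp A β x - x := by
    have h2 : A x = β • (x : X) - shift A β x := by rw [shift_apply]; abel
    rw [h2, map_sub, map_smul, resOp_apply A β (shift A β x), resDom_shift]
  have h3 : ‖Ext.emb A β (A x)‖ ≤ ‖β‖ * (‖resOp A β‖ * ‖(x : X)‖) + ‖(x : X)‖ := by
    rw [Ext.norm_emb, h1]
    refine (norm_sub_le _ _).trans ?_
    rw [norm_smul]
    gcongr
    exact (resOp A β).le_opNorm _
  refine h3.trans (le_of_eq ?_)
  simp only [Submodule.subtype_apply]
  ring

/-- The operator `α - A`, extended to a bounded operator from `X` to `X₋₁`. -/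
def Ext.shift [InResolventSet A β] (α : ℂ) : X →L[ℂ] Ext A β := α • Ext.emb A β - Ext.op A β

theorem Ext.shift_apply [InResolventSet A β] (hA : Dense (A.domain : Set X)) (α : ℂ)
    (x : A.domain) : Ext.shift A β α x = Ext.emb A β (DBR.shift A α x) := by
  simp [Ext.shift, Ext.op_apply A β hA, DBR.shift_apply]

theorem Ext.res_shift [InResolventSet A β] (hA : Dense (A.domain : Set X)) (x : X) :
    Ext.res A β (Ext.shift A β β x) = x := by
  refine congrFun (Continuous.ext_on hA (f := fun x => Ext.res A β (Ext.shift A β β x)) (g := id)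
    (by fun_prop) continuous_id fun x hx => ?_) x
  have := Ext.shift_apply A β hA β ⟨x, hx⟩
  simp only at this
  simp only [this, Ext.res_emb, resOp_apply, resDom_shift, id]

theorem Ext.shift_resOp [InResolventSet A β] (hA : Dense (A.domain : Set X)) (α : ℂ)
    [InResolventSet A α] (x : X) : Ext.shift A β α (resOp A α x) = Ext.emb A β x := by
  rw [resOp_apply, Ext.shift_apply A β hA, shift_resDom]

theorem Ext.shift_res [InResolventSet A β] (hA : Dense (A.domain : Set X)) (w : Ext A β) :
    Ext.shift A β β (Ext.res A β w) = w := by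
  refine congrFun ((Ext.denseRange_emb A β).equalizer
    (g := fun w => Ext.shift A β β (Ext.res A β w)) (h := id) (by fun_prop) continuous_id ?_) w
  ext x
  simp [Ext.shift_resOp A β hA]

/-- The extension of `α - A` is an isomorphism from `X` onto `X₋₁`, for every `α` in the resolvent
set of `A`. -/
theorem Ext.shift_isInvertible [InResolventSet A β] (hA : Dense (A.domain : Set X)) (α : ℂ)
    [InResolventSet A α] : (Ext.shift A β α).IsInvertible := by
  have hs : ∀ x, Ext.shift A β α x = Ext.shift A β β x + (α - β) • Ext.emb A β x := by
    intro x
    simp only [Ext.shift, sub_apply, smul_apply]; module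
  have hR : ∀ x : X, resOp A α x =
      resOp A β x + (β - α) • resOp A α (resOp A β x) := by
    intro x
    have h2 : resOp A α x = resOp A α (DBR.shift A β (resDom A β x)) := by
      rw [shift_resDom]
    have h3 : DBR.shift A β (resDom A β x) =
        DBR.shift A α (resDom A β x) + (β - α) • resOp A β x := by
      rw [DBR.shift_apply, DBR.shift_apply, resOp_apply]; module
    rw [h2, h3, map_add, map_smul, resOp_apply A α (DBR.shift A α _), resDom_shift]
    rfl
  refine ContinuousLinearMap.IsInvertible.of_inverse
    (g := (ContinuousLinearMap.id ℂ X + (β - α) • resOp A α) ∘L Ext.res A β) ?_ ?_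
  · ext w
    simp only [ContinuousLinearMap.comp_apply, add_apply, smul_apply,
      ContinuousLinearMap.id_apply, map_add, map_smul, Ext.shift_resOp A β hA]
    rw [hs, Ext.shift_res A β hA]
    module
  · ext x
    simp only [ContinuousLinearMap.comp_apply, add_apply, smul_apply,
      ContinuousLinearMap.id_apply, map_add, map_smul, hs, Ext.res_shift A β hA, Ext.res_emb]
    rw [hR x]
    module

/-- The inverse `(α - A)⁻¹` of the extension of `α - A`, as an operator from `X₋₁` to `X`. -/
def Ext.resAt [InResolventSet A β] (α : ℂ) : Ext A β →L[ℂ] X := (Ext.shift A β α).inverse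

end Ext

section adjoint
variable [CompleteSpace X] (A : X →ₗ.[ℂ] X) (β : ℂ)

theorem shift_adjoint_inner (hA : Dense (A.domain : Set X)) (α : ℂ) (z : A.adjoint.domain)
    (x : A.domain) : ⟪shift A.adjoint (conj α) z, (x : X)⟫_ℂ = ⟪(z : X), shift A α x⟫_ℂ := by
  rw [shift_apply, shift_apply, inner_sub_left, inner_sub_right, inner_smul_left,
    inner_smul_right, LinearPMap.adjoint_isFormalAdjoint hA z x]
  simp

/-- If `α` is in the resolvent set of `A` then `ᾱ` is in that of the adjoint of `A`. -/
theorem InResolventSet.adjoint (hA : Dense (A.domain : Set X)) (α : ℂ) [InResolventSet A α] :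
    InResolventSet A.adjoint (conj α) := by
  have h1 : ∀ z : A.adjoint.domain, (z : X) = ContinuousLinearMap.adjoint (resOp A α) (shift A.adjoint (conj α) z) := by
    intro z
    refine ext_inner_right ℂ fun x => ?_
    rw [ContinuousLinearMap.adjoint_inner_left, resOp_apply,
      shift_adjoint_inner A hA, shift_resDom]
  have h2 : ∀ w : X, ∃ z : A.adjoint.domain, shift A.adjoint (conj α) z = w := by
    intro w
    have h3 : ∀ x : A.domain, ⟪conj α • ContinuousLinearMap.adjoint (resOp A α) w - w, (x : X)⟫_ℂ =
        ⟪ContinuousLinearMap.adjoint (resOp A α) w, A x⟫_ℂ := by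
      intro x
      have h4 : A x = α • (x : X) - shift A α x := by rw [shift_apply]; abel
      rw [h4, inner_sub_right, ContinuousLinearMap.adjoint_inner_left _ (shift A α x),
        resOp_apply A α (shift A α x), resDom_shift, inner_sub_left, inner_smul_left,
        inner_smul_right]
      simp
    have h5 : ContinuousLinearMap.adjoint (resOp A α) w ∈ A.adjoint.domain :=
      LinearPMap.mem_adjoint_domain_of_exists _ ⟨_, h3⟩
    refine ⟨⟨_, h5⟩, ?_⟩
    rw [shift_apply, LinearPMap.adjoint_apply_eq hA ⟨_, h5⟩ h3]
    simp
  refine ⟨⟨fun z z' h => Subtype.ext ?_, h2⟩, ‖ContinuousLinearMap.adjoint (resOp A α)‖, fun z => ?_⟩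
  · rw [h1 z, h1 z', h]
  · conv_lhs => rw [h1 z]
    exact ContinuousLinearMap.le_opNorm _ _

/-- The duality pairing between `X₋₁` and the domain of the adjoint of `A`, with `X` as pivot space:
the continuous extension to `X₋₁` of the functional `x ↦ ⟨x, z⟩` (the inner product of Mathlib is
linear in its second argument). -/
def pairing [InResolventSet A β] (w : Ext A β) (z : A.adjoint.domain) : ℂ :=
  ⟪shift A.adjoint (conj β) z, Ext.res A β w⟫_ℂ

theorem pairing_emb [InResolventSet A β] (hA : Dense (A.domain : Set X)) (x : X) (z : A.adjoint.domain) :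
    pairing A β (Ext.emb A β x) z = ⟪(z : X), x⟫_ℂ := by
  rw [pairing, Ext.res_emb, resOp_apply, shift_adjoint_inner A hA, shift_resDom]

/-- The adjoint, with respect to the duality pairing, of a bounded operator `B` from `U` to `X₋₁`.
It is defined on the domain of the adjoint of `A`. -/
def dualMap {U : Type*} [NormedAddCommGroup U] [InnerProductSpace ℂ U] [CompleteSpace U]
    [InResolventSet A β] (B : U →L[ℂ] Ext A β) : A.adjoint.domain →ₗ[ℂ] U :=
  (ContinuousLinearMap.adjoint (Ext.res A β ∘L B)).toLinearMap ∘ₗ shift A.adjoint (conj β)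

/-- The defining property of `dualMap`. -/
theorem dualMap_inner {U : Type*} [NormedAddCommGroup U] [InnerProductSpace ℂ U] [CompleteSpace U]
    [InResolventSet A β] (B : U →L[ℂ] Ext A β) (u : U) (z : A.adjoint.domain) :
    ⟪dualMap A β B z, u⟫_ℂ = pairing A β (B u) z := by
  simp [dualMap, pairing, ContinuousLinearMap.adjoint_inner_left]

end adjoint
end rigging

section node

/-- The main operator `A` of the operator `S` from `X × U` to `X × Y`: it maps `x` to the first
component of `S (x, 0)`, for all `x` such that `(x, 0)` is in the domain of `S`. -/
def mainOp {X U Y : Type*} [AddCommGroup X] [Module ℂ X] [AddCommGroup U] [Module ℂ U]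
    [AddCommGroup Y] [Module ℂ Y] (S : (X × U) →ₗ.[ℂ] (X × Y)) : X →ₗ.[ℂ] X where
  domain := S.domain.comap (LinearMap.inl ℂ X U)
  toFun := LinearMap.fst ℂ X Y ∘ₗ S.toFun ∘ₗ (LinearMap.inl ℂ X U).restrict fun _ hx => hx

/-- The observation operator `C` of the operator `S` from `X × U` to `X × Y`: it maps `x` to the
second component of `S (x, 0)`, for all `x` in the domain of the main operator. -/
def obsOp {X U Y : Type*} [AddCommGroup X] [Module ℂ X] [AddCommGroup U] [Module ℂ U]
    [AddCommGroup Y] [Module ℂ Y] (S : (X × U) →ₗ.[ℂ] (X × Y)) : (mainOp S).domain →ₗ[ℂ] Y :=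
  LinearMap.snd ℂ X Y ∘ₗ S.toFun ∘ₗ (LinearMap.inl ℂ X U).restrict fun _ hx => hx

variable {U Y : Type*} [NormedAddCommGroup U] [InnerProductSpace ℂ U] [CompleteSpace U]
  [NormedAddCommGroup Y] [InnerProductSpace ℂ Y] [CompleteSpace Y] (φ : SchurFunction U Y)

instance : Fact (Kc φ).PosSemidef := ⟨Kc_posSemidef φ⟩

/-- The Hilbert space `H_c` of functions from the right half-plane to `U` with reproducing
kernel `K_c`. -/
def Hc : Type _ := RKHS.OfKernel (Kc φ)

instance : NormedAddCommGroup (Hc φ) := inferInstanceAs (NormedAddCommGroup (RKHS.OfKernel (Kc φ)))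
instance : InnerProductSpace ℂ (Hc φ) :=
  inferInstanceAs (InnerProductSpace ℂ (RKHS.OfKernel (Kc φ)))
instance : CompleteSpace (Hc φ) := inferInstanceAs (CompleteSpace (RKHS.OfKernel (Kc φ)))
instance : RKHS ℂ (Hc φ) CPlus U := inferInstanceAs (RKHS ℂ (RKHS.OfKernel (Kc φ)) CPlus U)

theorem kernel_Hc : RKHS.kernel (Hc φ) = Kc φ := RKHS.OfKernel.kernel_ofKernel

set_option linter.unusedSectionVars false

/-- The operator `e_c(μ)^*` from `U` to `H_c`, the adjoint of the evaluation at `μ`. -/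
abbrev ec (μ : CPlus) : U →L[ℂ] Hc φ := RKHS.kerFun (Hc φ) μ

theorem ec_apply (l μ : CPlus) (u : U) : ec φ l u μ = Kc φ μ l u := by
  rw [← kernel_Hc, RKHS.kerFun_apply]

/-- The graph of the operator `S_c` of the controllable energy-preserving model of `φ`: the closure
of the linear span of the pairs consisting of `(e_c(λ̄)^* u, u)` and
`(λ e_c(λ̄)^* u, φ(λ) u)`. -/
def nodeGraph : Submodule ℂ ((Hc φ × U) × (Hc φ × Y)) :=
  (Submodule.span ℂ {p | ∃ (l : CPlus) (u : U),
    p = ((ec φ l.conj u, u), ((l : ℂ) • ec φ l.conj u, φ.toFun l u))}).topologicalClosure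

/-- The operator `S_c = [A&B; C&D]_c` from `H_c × U` to `H_c × Y`, the closure of the map
`(e_c(λ̄)^* u, u) ↦ (λ e_c(λ̄)^* u, φ(λ) u)`. -/
def node : (Hc φ × U) →ₗ.[ℂ] (Hc φ × Y) := (nodeGraph φ).toLinearPMap

/-- The main operator `A_c` of the controllable model. -/
abbrev Ac : Hc φ →ₗ.[ℂ] Hc φ := mainOp (node φ)

/-- The observation operator `C_c` of the controllable model. -/
abbrev Cc : (Ac φ).domain →ₗ[ℂ] Y := obsOp (node φ)

theorem gen_mem (l : CPlus) (u : U) :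
    ((ec φ l.conj u, u), ((l : ℂ) • ec φ l.conj u, φ.toFun l u)) ∈ nodeGraph φ :=
  Submodule.le_topologicalClosure _ (Submodule.subset_span ⟨l, u, rfl⟩)

theorem re_inner_self {E : Type*} [NormedAddCommGroup E] [InnerProductSpace ℂ E] (x : E) :
    (⟪x, x⟫_ℂ).re = ‖x‖ ^ 2 := inner_self_eq_norm_sq (𝕜 := ℂ) x

/-- The sesquilinear form of the energy balance. -/
def energy (q : (Hc φ × U) × (Hc φ × Y)) : ((Hc φ × U) × (Hc φ × Y)) →L[ℂ] ℂ :=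
  innerSL ℂ q.1.2 ∘L .snd ℂ _ _ ∘L .fst ℂ _ _ - innerSL ℂ q.2.2 ∘L .snd ℂ _ _ ∘L .snd ℂ _ _ -
    innerSL ℂ q.2.1 ∘L .fst ℂ _ _ ∘L .fst ℂ _ _ - innerSL ℂ q.1.1 ∘L .fst ℂ _ _ ∘L .snd ℂ _ _

theorem energy_apply (q p : (Hc φ × U) × (Hc φ × Y)) : energy φ q p =
    ⟪q.1.2, p.1.2⟫_ℂ - ⟪q.2.2, p.2.2⟫_ℂ - ⟪q.2.1, p.1.1⟫_ℂ - ⟪q.1.1, p.2.1⟫_ℂ := rfl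

theorem energy_symm (q p : (Hc φ × U) × (Hc φ × Y)) : energy φ q p = conj (energy φ p q) := by
  simp only [energy_apply, map_sub, inner_conj_symm]
  ring

theorem energy_of_gen (q : (Hc φ × U) × (Hc φ × Y))
    (h : ∀ (l : CPlus) (u : U),
      energy φ q ((ec φ l.conj u, u), ((l : ℂ) • ec φ l.conj u, φ.toFun l u)) = 0) :
    ∀ p ∈ nodeGraph φ, energy φ q p = 0 := by
  have h1 : nodeGraph φ ≤ (energy φ q).ker := by
    refine Submodule.topologicalClosure_minimal _ ?_ (energy φ q).isClosed_ker
    rw [Submodule.span_le]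
    rintro p ⟨l, u, rfl⟩
    exact h l u
  exact fun p hp => h1 hp

theorem energy_eq_zero {q p : (Hc φ × U) × (Hc φ × Y)} (hq : q ∈ nodeGraph φ)
    (hp : p ∈ nodeGraph φ) : energy φ q p = 0 := by
  refine energy_of_gen φ q (fun l u => ?_) p hp
  rw [energy_symm, energy_of_gen φ _ (fun m v => ?_) q hq, map_zero]
  rw [energy_apply]
  simp only [inner_smul_left, inner_smul_right, RKHS.inner_kerFun, RKHS.coe_smul, Pi.smul_apply,
    ec_apply, Kc_inner, CPlus.coe_conj, CPlus.conj_conj, conj_conj]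
  have h1 := CPlus.add_ne m l.conj
  have h2 := CPlus.add_ne l.conj m
  rw [CPlus.coe_conj] at h1 h2
  field_simp
  ring

/-- The energy balance `2 Re ⟨z, x⟩ = ‖u‖² - ‖y‖²`. -/
theorem energy_balance {p : (Hc φ × U) × (Hc φ × Y)} (hp : p ∈ nodeGraph φ) :
    2 * (⟪p.1.1, p.2.1⟫_ℂ).re = ‖p.1.2‖ ^ 2 - ‖p.2.2‖ ^ 2 := by
  have h := congrArg Complex.re (energy_eq_zero φ hp hp)
  rw [energy_apply, ← inner_conj_symm p.2.1] at h
  simp only [sub_re, conj_re, zero_re, re_inner_self] at h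
  linarith

theorem nodeGraph_single : ∀ p ∈ nodeGraph φ, p.1 = 0 → p.2 = 0 := by
  intro p hp h1
  have h2 := energy_balance φ hp
  rw [h1] at h2
  have hy : p.2.2 = 0 := by
    have : ‖p.2.2‖ ^ 2 = 0 := by simpa using h2.symm
    simpa using this
  refine Prod.ext (RKHS.ext fun m => ext_inner_right ℂ fun u => ?_) hy
  have h3 := energy_eq_zero φ hp (gen_mem φ m.conj u)
  rw [energy_apply] at h3
  simpa [h1, hy] using h3

/-- `α - A_c` is bounded below. -/
theorem graph_bound (α : CPlus) {p : (Hc φ × U) × (Hc φ × Y)} (hp : p ∈ nodeGraph φ) :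
    2 * (α : ℂ).re * ‖p.1.1‖ ^ 2 + ‖p.2.2‖ ^ 2 ≤
      ‖p.1.2‖ ^ 2 + 2 * ‖p.1.1‖ * ‖(α : ℂ) • p.1.1 - p.2.1‖ := by
  have h := energy_balance φ hp
  have h1 := (Complex.re_le_norm _).trans
    (norm_inner_le_norm (𝕜 := ℂ) p.1.1 ((α : ℂ) • p.1.1 - p.2.1))
  rw [inner_sub_right, inner_smul_right, inner_self_eq_norm_sq_to_K, sub_re] at h1
  have h2 : ((α : ℂ) * ((‖p.1.1‖ : ℂ)) ^ 2).re = (α : ℂ).re * ‖p.1.1‖ ^ 2 := by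
    norm_cast
    exact re_mul_ofReal _ _
  have h3 : ((α : ℂ) * ((RCLike.ofReal ‖p.1.1‖ : ℂ)) ^ 2).re = (α : ℂ).re * ‖p.1.1‖ ^ 2 := h2
  rw [h3] at h1
  linarith

theorem toFun_continuous (u : U) : Continuous fun m : CPlus => φ.toFun m.conj u := by
  have h1 : Continuous fun m : CPlus => φ.toFun m.conj :=
    φ.holomorphic.continuousOn.comp_continuous
      (continuous_conj.comp continuous_subtype_val) fun m => m.conj.2
  exact h1.clm_apply continuous_const

theorem ec_continuous (u : U) : Continuous fun m : CPlus => ec φ m u := by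
  rw [continuous_iff_continuousAt]
  intro l
  have hφ := toFun_continuous φ u
  have h1 : ∀ m, ‖ec φ m u - ec φ l u‖ ^ 2 = (⟪Kc φ m m u, u⟫_ℂ - ⟪Kc φ l m u, u⟫_ℂ -
      (⟪Kc φ m l u, u⟫_ℂ - ⟪Kc φ l l u, u⟫_ℂ)).re := by
    intro m
    rw [← inner_self_eq_norm_sq (𝕜 := ℂ)]
    simp only [inner_sub_right, RKHS.inner_kerFun, RKHS.coe_sub, Pi.sub_apply, inner_sub_left,
      ec_apply, RCLike.re_eq_complex_re, sub_re]
    ring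
  have h2 : Continuous fun m : CPlus => ‖ec φ m u - ec φ l u‖ ^ 2 := by
    simp only [h1, Kc_inner]
    have hc : Continuous fun m : CPlus => (m : ℂ) := continuous_subtype_val
    have hcc : Continuous fun m : CPlus => conj (m : ℂ) := continuous_conj.comp hc
    refine continuous_re.comp ?_
    refine ((((hc.add hcc).inv₀ fun m => CPlus.add_ne m m.conj).mul
      (continuous_const.sub (hφ.inner hφ))).sub
      (((hc.add continuous_const).inv₀ fun m => CPlus.add_ne m l.conj).mul
      (continuous_const.sub (hφ.inner continuous_const)))).sub
      ((((continuous_const.add hcc).inv₀ fun m => CPlus.add_ne l m.conj).mul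
      (continuous_const.sub (continuous_const.inner hφ))).sub continuous_const)
  rw [ContinuousAt, tendsto_iff_norm_sub_tendsto_zero]
  have h3 := (h2.tendsto l).sqrt
  simpa using h3

/-- The map `(x, u) ↦ (α x - z, u)` on the graph. -/
def graphMap (α : ℂ) : ((Hc φ × U) × (Hc φ × Y)) →L[ℂ] (Hc φ × U) :=
  ContinuousLinearMap.prod (α • (.fst ℂ _ _ ∘L .fst ℂ _ _) - .fst ℂ _ _ ∘L .snd ℂ _ _)
    (.snd ℂ _ _ ∘L .fst ℂ _ _)

theorem graphMap_apply (α : ℂ) (p : (Hc φ × U) × (Hc φ × Y)) :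
    graphMap φ α p = (α • p.1.1 - p.2.1, p.1.2) := rfl

theorem graphMap_bound (α : CPlus) :
    ∃ C : ℝ≥0, ∀ p ∈ nodeGraph φ, ‖p‖ ≤ C * ‖graphMap φ α p‖ := by
  obtain ⟨α, hα⟩ := α
  set r := α.re
  have hr : 0 < r⁻¹ := inv_pos.mpr hα
  have hD : 0 < 1 + (1 + r⁻¹) * r⁻¹ := by positivity
  refine ⟨⟨(1 + (1 + r⁻¹) * r⁻¹) + (1 + r⁻¹) + ‖α‖ * (1 + (1 + r⁻¹) * r⁻¹) + 1, by positivity⟩,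
    fun p hp => ?_⟩
  have hb := graph_bound φ ⟨α, hα⟩ hp
  have hm := graphMap_apply φ α p
  have hf : ‖α • p.1.1 - p.2.1‖ ≤ ‖graphMap φ α p‖ := by rw [hm]; exact le_max_left _ _
  have hu : ‖p.1.2‖ ≤ ‖graphMap φ α p‖ := by rw [hm]; exact le_max_right _ _
  simp only at hb
  set n := ‖graphMap φ α p‖
  have hn : 0 ≤ n := norm_nonneg _
  set a := ‖p.1.1‖
  have ha : 0 ≤ a := norm_nonneg _
  have h1 : r * a ^ 2 + ‖p.2.2‖ ^ 2 ≤ (1 + r⁻¹) * n ^ 2 := by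
    have h2 : 2 * a * ‖α • p.1.1 - p.2.1‖ ≤ 2 * a * n := by gcongr
    have h3 : 2 * a * n ≤ r * a ^ 2 + r⁻¹ * n ^ 2 := by
      have h4 : 0 ≤ r⁻¹ * (r * a - n) ^ 2 := by positivity
      have h5 : r⁻¹ * (r * a - n) ^ 2 = r * a ^ 2 + r⁻¹ * n ^ 2 - 2 * a * n := by
        field_simp; ring
      linarith
    have h6 : ‖p.1.2‖ ^ 2 ≤ n ^ 2 := by gcongr
    nlinarith
  have hx : a ≤ (1 + (1 + r⁻¹) * r⁻¹) * n := by
    refine le_of_sq_le_sq ?_ (by positivity)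
    have h2 : r * a ^ 2 ≤ (1 + r⁻¹) * n ^ 2 := by nlinarith [sq_nonneg ‖p.2.2‖]
    have h3 : a ^ 2 ≤ (1 + r⁻¹) * r⁻¹ * n ^ 2 := by
      have := mul_le_mul_of_nonneg_left h2 hr.le
      have e : r⁻¹ * (r * a ^ 2) = a ^ 2 := by field_simp
      rw [e] at this
      linarith
    have h4 : (1 + r⁻¹) * r⁻¹ ≤ (1 + (1 + r⁻¹) * r⁻¹) ^ 2 := by nlinarith [mul_pos hr hr]
    rw [mul_pow]
    exact h3.trans (by gcongr)
  have hy : ‖p.2.2‖ ≤ (1 + r⁻¹) * n := by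
    refine le_of_sq_le_sq ?_ (by positivity)
    have h2 : ‖p.2.2‖ ^ 2 ≤ (1 + r⁻¹) * n ^ 2 := by nlinarith [mul_nonneg hα.le (sq_nonneg a)]
    rw [mul_pow]
    exact h2.trans (by gcongr; nlinarith)
  have hz : ‖p.2.1‖ ≤ ‖α‖ * ((1 + (1 + r⁻¹) * r⁻¹) * n) + n := by
    have h2 : p.2.1 = α • p.1.1 - (α • p.1.1 - p.2.1) := by abel
    rw [h2]
    refine (norm_sub_le _ _).trans ?_
    rw [norm_smul]
    gcongr
  have hmax : ‖p‖ = max (max a ‖p.1.2‖) (max ‖p.2.1‖ ‖p.2.2‖) := rfl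
  rw [hmax]
  have e1 : 0 ≤ (1 + (1 + r⁻¹) * r⁻¹) * n := by positivity
  have e2 : 0 ≤ (1 + r⁻¹) * n := by positivity
  have e3 : 0 ≤ ‖α‖ * ((1 + (1 + r⁻¹) * r⁻¹) * n) := by positivity
  show _ ≤ ((1 + (1 + r⁻¹) * r⁻¹) + (1 + r⁻¹) + ‖α‖ * (1 + (1 + r⁻¹) * r⁻¹) + 1) * n
  refine max_le (max_le ?_ ?_) (max_le ?_ ?_) <;> linarith

theorem graphMap_surj (α : CPlus) (w : Hc φ × U) : ∃ p ∈ nodeGraph φ, graphMap φ α p = w := by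
  obtain ⟨C, hC⟩ := graphMap_bound φ α
  have hcl : IsClosed (nodeGraph φ : Set ((Hc φ × U) × (Hc φ × Y))) :=
    Submodule.isClosed_topologicalClosure _
  have : CompleteSpace (nodeGraph φ) := hcl.completeSpace_coe
  set T : nodeGraph φ →L[ℂ] (Hc φ × U) := graphMap φ α ∘L (nodeGraph φ).subtypeL
  have hT : AntilipschitzWith C T := T.antilipschitz_of_bound fun p => hC p.1 p.2
  have hrange : IsClosed (T.range : Set (Hc φ × U)) := by
    have := hT.isClosed_range T.uniformContinuous
    exact this
  have h0 : ∀ u : U, ((0 : Hc φ), u) ∈ T.range := fun u =>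
    ⟨⟨_, gen_mem φ α u⟩, by simp [T, graphMap_apply]⟩
  set W : Submodule ℂ (Hc φ) := T.range.comap (LinearMap.inl ℂ (Hc φ) U)
  have hW : IsClosed (W : Set (Hc φ)) :=
    hrange.preimage (continuous_id.prodMk continuous_const : Continuous fun x : Hc φ => (x, (0 : U)))
  have h1 : ∀ (l : CPlus) (u : U), l ≠ α.conj → ec φ l u ∈ W := by
    intro l u hl
    have h2 : (α : ℂ) - conj (l : ℂ) ≠ 0 := by
      intro h
      refine hl (Subtype.ext ?_)
      rw [CPlus.coe_conj, sub_eq_zero.mp h, conj_conj]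
    have h3 : ((((α : ℂ) - conj (l : ℂ)) • ec φ l u, u) : Hc φ × U) ∈ T.range := by
      refine ⟨⟨_, gen_mem φ l.conj u⟩, ?_⟩
      simp [T, graphMap_apply, sub_smul]
    have h4 := T.range.smul_mem ((α : ℂ) - conj (l : ℂ))⁻¹ (T.range.sub_mem h3 (h0 u))
    show (ec φ l u, (0 : U)) ∈ T.range
    convert h4 using 1
    simp [smul_smul, h2]
  have h2 : ∀ (l : CPlus) (u : U), ec φ l u ∈ W := by
    intro l u
    by_cases hl : l = α.conj
    · let s : ℕ → CPlus := fun n => ⟨(l : ℂ) + ((1 / ((n : ℝ) + 1) : ℝ) : ℂ), by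
        have := l.2
        rw [add_re, ofReal_re]
        positivity⟩
      have hs : Filter.Tendsto s Filter.atTop (nhds l) := by
        rw [tendsto_subtype_rng]
        have := (continuous_ofReal.tendsto 0).comp (tendsto_one_div_add_atTop_nhds_zero_nat (𝕜 := ℝ))
        simpa [s] using this.const_add (l : ℂ)
      refine hW.mem_of_tendsto (((ec_continuous φ u).tendsto l).comp hs)
        (Filter.Eventually.of_forall fun n => h1 _ _ ?_)
      rw [← hl]
      intro h
      have h3 := congrArg (fun z : CPlus => (z : ℂ)) h
      simp only [s, add_eq_left, ofReal_eq_zero] at h3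
      exact (by positivity : (1 / ((n : ℝ) + 1)) ≠ 0) h3
    · exact h1 l u hl
  have h3 : W = ⊤ := by
    rw [eq_top_iff, ← RKHS.kerFun_dense (Hc φ)]
    refine Submodule.topologicalClosure_minimal _ ?_ hW
    rw [Submodule.span_le]
    rintro x ⟨l, u, rfl⟩
    exact h2 l u
  have h4 : (w.1, (0 : U)) ∈ T.range := by
    have : w.1 ∈ W := by rw [h3]; trivial
    exact this
  obtain ⟨p, hp⟩ := T.range.add_mem h4 (h0 w.2)
  refine ⟨p.1, p.2, ?_⟩
  have : graphMap φ α p.1 = T p := rfl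
  rw [this]
  simpa using hp

theorem node_graph : (node φ).graph = nodeGraph φ :=
  Submodule.toLinearPMap_graph_eq _ (nodeGraph_single φ)

theorem node_mem (p : (node φ).domain) : ((p : Hc φ × U), node φ p) ∈ nodeGraph φ := by
  rw [← node_graph]
  exact (node φ).mem_graph p

theorem Ac_mem (x : (Ac φ).domain) : (((x : Hc φ), (0 : U)), (Ac φ x, Cc φ x)) ∈ nodeGraph φ :=
  node_mem φ ⟨((x : Hc φ), (0 : U)), x.2⟩

theorem exists_Ac {x z : Hc φ} {y : Y} (h : ((x, (0 : U)), (z, y)) ∈ nodeGraph φ) :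
    ∃ d : (Ac φ).domain, (d : Hc φ) = x ∧ Ac φ d = z ∧ Cc φ d = y := by
  rw [← node_graph, LinearPMap.mem_graph_iff] at h
  obtain ⟨p, hp, hz⟩ := h
  have h1 : x ∈ (Ac φ).domain := by
    show (x, (0 : U)) ∈ (node φ).domain
    have h2 := p.2
    rw [hp] at h2
    exact h2
  obtain ⟨p, hp2⟩ := p
  simp only at hp
  subst hp
  have h3 : node φ ⟨(x, (0 : U)), hp2⟩ = (z, y) := hz
  exact ⟨⟨x, h1⟩, rfl, congrArg Prod.fst h3, congrArg Prod.snd h3⟩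

/-- The right half-plane is contained in the resolvent set of `A_c`. -/
instance Ac_resolvent (α : CPlus) : InResolventSet (Ac φ) α := by
  obtain ⟨C, hC⟩ := graphMap_bound φ α
  have hb : ∀ x : (Ac φ).domain, ‖(x : Hc φ)‖ ≤ C * ‖shift (Ac φ) α x‖ := by
    intro x
    have h1 := hC _ (Ac_mem φ x)
    rw [graphMap_apply] at h1
    have h2 : ‖(((α : ℂ) • (x : Hc φ) - Ac φ x, (0 : U)) : Hc φ × U)‖ = ‖shift (Ac φ) α x‖ := by
      rw [shift_apply, Prod.norm_mk, norm_zero]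
      exact max_eq_left (norm_nonneg _)
    simp only at h1
    rw [h2] at h1
    exact ((le_max_left _ _).trans (le_max_left _ _)).trans h1
  refine ⟨⟨?_, fun w => ?_⟩, C, hb⟩
  · refine (injective_iff_map_eq_zero _).mpr fun x hx => ?_
    have := hb x
    rw [hx, norm_zero, mul_zero] at this
    exact Subtype.ext (norm_le_zero_iff.mp this)
  · obtain ⟨⟨⟨x, u⟩, ⟨z, y⟩⟩, hp, hw⟩ := graphMap_surj φ α (w, 0)
    rw [graphMap_apply, Prod.mk.injEq] at hw
    simp only at hw
    obtain ⟨hw, rfl⟩ := hw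
    obtain ⟨d, rfl, rfl, -⟩ := exists_Ac φ hp
    exact ⟨d, hw⟩

theorem Ac_dense : Dense ((Ac φ).domain : Set (Hc φ)) := by
  rw [Submodule.dense_iff_topologicalClosure_eq_top,
    Submodule.topologicalClosure_eq_top_iff, Submodule.eq_bot_iff]
  intro y hy
  rw [Submodule.mem_orthogonal] at hy
  let α : CPlus := ⟨1, by simp⟩
  have hr := Ac_resolvent φ α
  set x := resDom (Ac φ) (α : ℂ) y
  have h1 := hy x x.2
  have h2 : shift (Ac φ) α x = y := shift_resDom _ _ _
  have h3 := energy_balance φ (Ac_mem φ x)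
  have h4 := congrArg Complex.re h1
  rw [← h2, shift_apply, inner_sub_right, inner_smul_right] at h4
  simp only [α, one_mul, sub_re, zero_re, re_inner_self] at h4
  simp only [norm_zero] at h3
  have h5 : ‖(x : Hc φ)‖ ^ 2 = 0 := by nlinarith [sq_nonneg ‖(x : Hc φ)‖, sq_nonneg ‖Cc φ x‖]
  have h6 : x = 0 := Subtype.ext (by simpa using h5)
  rw [← h2, h6, map_zero]

/-- The right half-plane is contained in the resolvent set of the adjoint of `A_c`. -/
instance Ac_adjoint_resolvent (α : CPlus) : InResolventSet (Ac φ).adjoint α := by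
  have := InResolventSet.adjoint (Ac φ) (Ac_dense φ) (α.conj : ℂ)
  rwa [CPlus.coe_conj, conj_conj] at this

end node

section rigged

variable {U Y : Type*} [NormedAddCommGroup U] [InnerProductSpace ℂ U] [CompleteSpace U]
  [NormedAddCommGroup Y] [InnerProductSpace ℂ Y] [CompleteSpace Y] (φ : SchurFunction U Y)

/-- Functions in `H_c` that agree except possibly at one point are equal. -/
theorem Hc_ext_off (b : CPlus) {f g : Hc φ} (h : ∀ μ : CPlus, μ ≠ b → f μ = g μ) : f = g := by
  refine RKHS.ext fun l => ext_inner_right ℂ fun u => ?_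
  by_cases hl : l = b
  · have hf : ∀ f : Hc φ, Continuous fun m : CPlus => ⟪f m, u⟫_ℂ := fun f => by
      simp only [← RKHS.inner_kerFun]
      exact continuous_const.inner (ec_continuous φ u)
    let s : ℕ → CPlus := fun n => ⟨(l : ℂ) + ((1 / ((n : ℝ) + 1) : ℝ) : ℂ), by
      have := l.2
      rw [add_re, ofReal_re]
      positivity⟩
    have hs : Filter.Tendsto s Filter.atTop (nhds l) := by
      rw [tendsto_subtype_rng]
      have := (continuous_ofReal.tendsto 0).comp
        (tendsto_one_div_add_atTop_nhds_zero_nat (𝕜 := ℝ))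
      simpa [s] using this.const_add (l : ℂ)
    have hne : ∀ n, s n ≠ b := by
      intro n h
      rw [← hl] at h
      have h3 := congrArg (fun z : CPlus => (z : ℂ)) h
      simp only [s, add_eq_left, ofReal_eq_zero] at h3
      exact (by positivity : (1 / ((n : ℝ) + 1)) ≠ 0) h3
    refine tendsto_nhds_unique (((hf f).tendsto l).comp hs) ?_
    refine (((hf g).tendsto l).comp hs).congr fun n => ?_
    simp only [Function.comp_apply, h _ (hne n)]
  · rw [h l hl]

/-- The control operator `B_c` from `U` to the extrapolation space `H_{c,-1}` exists and is unique:
the first component of `S_c (x, u)` is `A_c|_{H_c} x + B_c u`. -/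
theorem exists_control (β : CPlus) : ∃! B : U →L[ℂ] Ext (Ac φ) β, ∀ p : (node φ).domain,
    Ext.emb (Ac φ) β (node φ p).1 = Ext.op (Ac φ) β (p : Hc φ × U).1 + B (p : Hc φ × U).2 := by
  have hgen : ∀ u : U, ∃ p : (node φ).domain, (p : Hc φ × U) = (ec φ β.conj u, u) ∧
      node φ p = ((β : ℂ) • ec φ β.conj u, φ.toFun β u) := by
    intro u
    have h := gen_mem φ β u
    rw [← node_graph, LinearPMap.mem_graph_iff] at h
    exact h
  refine ⟨Ext.shift (Ac φ) β β ∘L ec φ β.conj, fun p => ?_, fun B hB => ?_⟩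
  · obtain ⟨q, hq1, hq2⟩ := hgen (p : Hc φ × U).2
    have hm := (nodeGraph φ).sub_mem (node_mem φ p) (node_mem φ q)
    rw [hq1, hq2] at hm
    have hm2 : (((p : Hc φ × U).1 - ec φ β.conj (p : Hc φ × U).2, (0 : U)),
        ((node φ p).1 - (β : ℂ) • ec φ β.conj (p : Hc φ × U).2,
          (node φ p).2 - φ.toFun β (p : Hc φ × U).2)) ∈ nodeGraph φ := by
      convert hm using 1
      simp [Prod.ext_iff]
    obtain ⟨d, hd1, hd2, -⟩ := exists_Ac φ hm2
    have h1 := Ext.op_apply (Ac φ) β (Ac_dense φ) d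
    rw [hd1, hd2, map_sub, map_sub, map_smul] at h1
    have h2 : Ext.emb (Ac φ) β (node φ p).1 = Ext.op (Ac φ) β (p : Hc φ × U).1 -
        Ext.op (Ac φ) β (ec φ β.conj (p : Hc φ × U).2) +
        (β : ℂ) • Ext.emb (Ac φ) β (ec φ β.conj (p : Hc φ × U).2) := by
      rw [h1]; abel
    rw [h2]
    simp only [ContinuousLinearMap.comp_apply, Ext.shift, sub_apply, smul_apply]
    abel
  · ext u
    obtain ⟨q, hq1, hq2⟩ := hgen u
    have h := hB q
    rw [hq1, hq2, map_smul] at h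
    simp only at h
    simp only [ContinuousLinearMap.comp_apply, Ext.shift, sub_apply, smul_apply]
    rw [h]
    abel

/-- The control operator `B_c` of the controllable model, from `U` to the extrapolation space. -/
def Bc (β : CPlus) : U →L[ℂ] Ext (Ac φ) β := (exists_control φ β).choose

/-- The defining property of `B_c`. -/
theorem Bc_spec (β : CPlus) (p : (node φ).domain) : Ext.emb (Ac φ) β (node φ p).1 =
    Ext.op (Ac φ) β (p : Hc φ × U).1 + Bc φ β (p : Hc φ × U).2 :=
  (exists_control φ β).choose_spec.1 p

/-- The operator `B_c^*`, from the domain of `A_c^*` to `U`. -/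
def BcDual (β : CPlus) : (Ac φ).adjoint.domain →ₗ[ℂ] U := dualMap (Ac φ) β (Bc φ β)

/-- The operator `(α - A_c|_{H_c})⁻¹ B_c` from `U` to `H_c`. -/
def resB (β α : CPlus) : U →L[ℂ] Hc φ := Ext.resAt (Ac φ) β α ∘L Bc φ β

/-- The inverse used in `resB` is a genuine one. -/
theorem shift_resB (β α : CPlus) (u : U) : Ext.shift (Ac φ) β α (resB φ β α u) = Bc φ β u := by
  obtain ⟨e, he⟩ := Ext.shift_isInvertible (Ac φ) β (Ac_dense φ) α
  rw [resB, ContinuousLinearMap.comp_apply, Ext.resAt, ← he,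
    ContinuousLinearMap.inverse_equiv]
  exact e.apply_symm_apply _

/-- The operator `τ_{c,α} = C_c (α - A_c)⁻¹` from `H_c` to `Y`. -/
def tau (α : CPlus) : Hc φ →ₗ[ℂ] Y := Cc φ ∘ₗ resDom (Ac φ) α

/-- The rigged space `H_{c,1}` (for `A = A_c`) or `H^d_{c,1}` (for `A = A_c^*`) is a reproducing
kernel Hilbert space, with the point evaluations inherited from `H_c`. -/
instance (A : Hc φ →ₗ.[ℂ] Hc φ) (b : ℂ) [InResolventSet A b] : RKHS ℂ (RigOne A b) CPlus U where
  coeCLM := RKHS.coeCLM ℂ ∘L RigOne.incl A b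
  coeCLM_injective := RKHS.coeCLM_injective.comp (RigOne.incl_injective A b)

/-- The space `H_{c,1}`: the domain of `A_c` with the norm `‖(β - A_c) x‖`. -/
abbrev HcOne (β : CPlus) : Type _ := RigOne (Ac φ) β

/-- The space `H^d_{c,1}`: the domain of `A_c^*` with the norm `‖(β̄ - A_c^*) x‖`. -/
abbrev HcdOne (β : CPlus) : Type _ := RigOne (Ac φ).adjoint β.conj

section HcdMinus

/-- The functions `x` for which `μ ↦ (x(μ) - x(β̄)) / (β̄ - μ)` is in `H_c`, in the sense that it
extends over the removable singularity at `β̄` to a function in `H_c`. -/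
def HcdMinusFun (β : CPlus) : Submodule ℂ (CPlus → U) where
  carrier := {x | ∃ g : Hc φ, ∀ μ : CPlus, (conj (β : ℂ) - μ) • g μ = x μ - x β.conj}
  zero_mem' := ⟨0, fun μ => by simp⟩
  add_mem' := by
    rintro x y ⟨g, hg⟩ ⟨k, hk⟩
    refine ⟨g + k, fun μ => ?_⟩
    simp only [RKHS.coe_add, Pi.add_apply, smul_add, hg, hk]
    abel
  smul_mem' := by
    rintro c x ⟨g, hg⟩
    refine ⟨c • g, fun μ => ?_⟩
    simp only [RKHS.coe_smul, Pi.smul_apply, smul_comm _ c, hg, smul_sub]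

variable {φ}

theorem HcdMinus_unique {β : CPlus} {x : CPlus → U} {g k : Hc φ}
    (hg : ∀ μ : CPlus, (conj (β : ℂ) - μ) • g μ = x μ - x β.conj)
    (hk : ∀ μ : CPlus, (conj (β : ℂ) - μ) • k μ = x μ - x β.conj) : g = k := by
  refine Hc_ext_off φ β.conj fun μ hμ => ?_
  have h0 : conj (β : ℂ) - μ ≠ 0 := by
    intro h
    exact hμ (Subtype.ext (sub_eq_zero.mp h).symm)
  exact smul_right_injective U h0 ((hg μ).trans (hk μ).symm)

/-- The function `μ ↦ (x(μ) - x(β̄)) / (β̄ - μ)` in `H_c`. -/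
def HcdMinusFun.quot (β : CPlus) : HcdMinusFun φ β →ₗ[ℂ] Hc φ where
  toFun x := x.2.choose
  map_add' x y := HcdMinus_unique (x + y).2.choose_spec fun μ => by
    simp only [RKHS.coe_add, Pi.add_apply, smul_add, x.2.choose_spec μ, y.2.choose_spec μ,
      Submodule.coe_add]
    abel
  map_smul' c x := HcdMinus_unique (c • x).2.choose_spec fun μ => by
    simp only [RKHS.coe_smul, Pi.smul_apply, smul_comm _ c, x.2.choose_spec μ, smul_sub,
      RingHom.id_apply, Submodule.coe_smul]

theorem HcdMinusFun.quot_spec (β : CPlus) (x : HcdMinusFun φ β) (μ : CPlus) :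
    (conj (β : ℂ) - μ) • HcdMinusFun.quot β x μ = x.1 μ - x.1 β.conj := x.2.choose_spec μ

variable (φ)

/-- The constant functions, as a subspace of `HcdMinusFun φ β`. -/
def HcdMinusFun.const (β : CPlus) : Submodule ℂ (HcdMinusFun φ β) where
  carrier := {x | ∃ v : U, ∀ μ : CPlus, x.1 μ = v}
  zero_mem' := ⟨0, fun _ => rfl⟩
  add_mem' := by
    rintro x y ⟨v, hv⟩ ⟨w, hw⟩
    exact ⟨v + w, fun μ => by simp [hv, hw]⟩
  smul_mem' := by
    rintro c x ⟨v, hv⟩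
    exact ⟨c • v, fun μ => by simp [hv]⟩

/-- The space `H^d_{c,-1}`: the functions `x` for which `μ ↦ (x(μ) - x(β̄)) / (β̄ - μ)` is in `H_c`,
modulo the constant functions. -/
def HcdMinus (β : CPlus) : Type _ := HcdMinusFun φ β ⧸ HcdMinusFun.const φ β

instance (β : CPlus) : AddCommGroup (HcdMinus φ β) :=
  inferInstanceAs (AddCommGroup (HcdMinusFun φ β ⧸ HcdMinusFun.const φ β))
instance (β : CPlus) : Module ℂ (HcdMinus φ β) :=
  inferInstanceAs (Module ℂ (HcdMinusFun φ β ⧸ HcdMinusFun.const φ β))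

/-- The equivalence class `[x]`. -/
def HcdMinus.mk (β : CPlus) : HcdMinusFun φ β →ₗ[ℂ] HcdMinus φ β := (HcdMinusFun.const φ β).mkQ

/-- The map `[x] ↦ (μ ↦ (x(μ) - x(β̄)) / (β̄ - μ))` from `H^d_{c,-1}` to `H_c`. -/
def HcdMinus.quot (β : CPlus) : HcdMinus φ β →ₗ[ℂ] Hc φ :=
  (HcdMinusFun.const φ β).liftQ (HcdMinusFun.quot β) fun x ⟨v, hv⟩ => by
    rw [LinearMap.mem_ker]
    refine HcdMinus_unique (x := x.1) (HcdMinusFun.quot_spec β x) fun μ => ?_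
    simp [hv]

theorem HcdMinus.quot_mk (β : CPlus) (x : HcdMinusFun φ β) :
    HcdMinus.quot φ β (HcdMinus.mk φ β x) = HcdMinusFun.quot β x := rfl

theorem HcdMinus.quot_injective (β : CPlus) : Function.Injective (HcdMinus.quot φ β) := by
  refine (injective_iff_map_eq_zero _).mpr fun z hz => ?_
  obtain ⟨x, rfl⟩ := Submodule.mkQ_surjective _ z
  refine (Submodule.Quotient.mk_eq_zero _).mpr ⟨x.1 β.conj, fun μ => ?_⟩
  have h1 : HcdMinusFun.quot β x = 0 := hz
  have h2 := HcdMinusFun.quot_spec β x μ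
  rw [h1, RKHS.coe_zero, Pi.zero_apply, smul_zero] at h2
  exact sub_eq_zero.mp h2.symm

theorem HcdMinus.quot_surjective (β : CPlus) : Function.Surjective (HcdMinus.quot φ β) := by
  intro g
  have hx : (fun μ : CPlus => (conj (β : ℂ) - μ) • g μ) ∈ HcdMinusFun φ β :=
    ⟨g, fun μ => by simp⟩
  refine ⟨HcdMinus.mk φ β ⟨_, hx⟩, ?_⟩
  rw [HcdMinus.quot_mk]
  exact HcdMinus_unique (x := fun μ : CPlus => (conj (β : ℂ) - μ) • g μ)
    (HcdMinusFun.quot_spec β ⟨_, hx⟩) fun μ => by simp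

/-- The norm of `[x]` is the norm in `H_c` of `μ ↦ (x(μ) - x(β̄)) / (β̄ - μ)`. -/
instance (β : CPlus) : NormedAddCommGroup (HcdMinus φ β) :=
  NormedAddCommGroup.induced (HcdMinus φ β) (Hc φ) (HcdMinus.quot φ β)
    (HcdMinus.quot_injective φ β)

instance (β : CPlus) : InnerProductSpace ℂ (HcdMinus φ β) :=
  InnerProductSpace.induced (HcdMinus.quot φ β)

theorem HcdMinus.norm_eq (β : CPlus) (z : HcdMinus φ β) : ‖z‖ = ‖HcdMinus.quot φ β z‖ := rfl

instance (β : CPlus) : CompleteSpace (HcdMinus φ β) := by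
  have h1 : Isometry (HcdMinus.quot φ β) :=
    AddMonoidHomClass.isometry_of_norm _ fun x => (HcdMinus.norm_eq φ β x).symm
  exact (h1.isUniformInducing.completeSpace_congr (HcdMinus.quot_surjective φ β)).mpr inferInstance

/-- The point evaluations `[x] ↦ x(μ) - x(β̄)`. -/
def HcdMinus.eval (β : CPlus) : HcdMinus φ β →ₗ[ℂ] CPlus → U :=
  (HcdMinusFun.const φ β).liftQ
    { toFun := fun x μ => x.1 μ - x.1 β.conj
      map_add' := fun x y => by
        ext μ
        simp only [Submodule.coe_add, Pi.add_apply]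
        abel
      map_smul' := fun c x => by
        ext μ
        simp [smul_sub] } fun x ⟨v, hv⟩ => by
    rw [LinearMap.mem_ker]
    ext μ
    simp [hv]

theorem HcdMinus.eval_mk (β : CPlus) (x : HcdMinusFun φ β) (μ : CPlus) :
    HcdMinus.eval φ β (HcdMinus.mk φ β x) μ = x.1 μ - x.1 β.conj := rfl

theorem HcdMinus.eval_eq (β : CPlus) (z : HcdMinus φ β) (μ : CPlus) :
    HcdMinus.eval φ β z μ = (conj (β : ℂ) - μ) • HcdMinus.quot φ β z μ := by
  obtain ⟨x, rfl⟩ := Submodule.mkQ_surjective _ z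
  exact (HcdMinusFun.quot_spec β x μ).symm

theorem HcdMinus.quot_continuous (β : CPlus) : Continuous (HcdMinus.quot φ β) :=
  (AddMonoidHomClass.isometry_of_norm _ fun x => (HcdMinus.norm_eq φ β x).symm).continuous

/-- `H^d_{c,-1}` as a reproducing kernel Hilbert space, with the point evaluations
`[x] ↦ x(μ) - x(β̄)`. -/
instance (β : CPlus) : RKHS ℂ (HcdMinus φ β) CPlus U where
  coeCLM := ⟨HcdMinus.eval φ β, continuous_pi fun μ => by
    have h : (fun z => HcdMinus.eval φ β z μ) =
        fun z => (conj (β : ℂ) - μ) • HcdMinus.quot φ β z μ :=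
      funext fun z => HcdMinus.eval_eq φ β z μ
    exact h ▸ ((RKHS.continuous_eval μ).comp (HcdMinus.quot_continuous φ β)).const_smul _⟩
  coeCLM_injective := by
    intro z w h
    refine HcdMinus.quot_injective φ β (Hc_ext_off φ β.conj fun μ hμ => ?_)
    have h0 : conj (β : ℂ) - μ ≠ 0 := by
      intro h
      exact hμ (Subtype.ext (sub_eq_zero.mp h).symm)
    refine smul_right_injective U h0 ?_
    have h1 : HcdMinus.eval φ β z μ = HcdMinus.eval φ β w μ := congrFun h μ
    simpa only [HcdMinus.eval_eq] using h1

end HcdMinus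

section HcMinus

/-- The condition that a function of the form `μ ↦ φ̃(μ) y / (α + μ)` is in `H_c` only if it is
zero. -/
class Cond (α : CPlus) : Prop where
  eq_zero : ∀ (y : Y) (g : Hc φ), (∀ μ : CPlus, g μ = ((α : ℂ) + μ)⁻¹ • tilde φ μ y) → g = 0

/-- The functions `x` such that `μ ↦ (x(μ) + φ̃(μ) y) / (β + μ)` is in `H_c` for some `y`. -/
def HcMinusFun (β : CPlus) : Submodule ℂ (CPlus → U) where
  carrier := {x | ∃ (y : Y) (g : Hc φ), ∀ μ : CPlus,
    g μ = ((β : ℂ) + μ)⁻¹ • (x μ + tilde φ μ y)}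
  zero_mem' := ⟨0, 0, fun μ => by simp⟩
  add_mem' := by
    rintro x x' ⟨y, g, hg⟩ ⟨y', g', hg'⟩
    refine ⟨y + y', g + g', fun μ => ?_⟩
    simp only [RKHS.coe_add, Pi.add_apply, hg, hg', map_add, ← smul_add]
    congr 1
    abel
  smul_mem' := by
    rintro c x ⟨y, g, hg⟩
    refine ⟨c • y, c • g, fun μ => ?_⟩
    simp only [RKHS.coe_smul, Pi.smul_apply, hg, map_smul, smul_comm c, smul_add]

variable {φ}

theorem HcMinus_unique {β : CPlus} [h : Cond φ β] {x : CPlus → U} {g k : Hc φ} {y z : Y}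
    (hg : ∀ μ : CPlus, g μ = ((β : ℂ) + μ)⁻¹ • (x μ + tilde φ μ y))
    (hk : ∀ μ : CPlus, k μ = ((β : ℂ) + μ)⁻¹ • (x μ + tilde φ μ z)) : g = k := by
  refine sub_eq_zero.mp (h.eq_zero (y - z) (g - k) fun μ => ?_)
  rw [RKHS.coe_sub, Pi.sub_apply, hg, hk, ← smul_sub, map_sub]
  congr 1
  abel

/-- A choice of `y_x` in `Y` such that `μ ↦ (x(μ) + φ̃(μ) y_x) / (β + μ)` is in `H_c`. -/
def HcMinusFun.y (β : CPlus) (x : HcMinusFun φ β) : Y := x.2.choose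

/-- The function `μ ↦ (x(μ) + φ̃(μ) y_x) / (β + μ)` in `H_c`. -/
def HcMinusFun.quotFun (β : CPlus) (x : HcMinusFun φ β) : Hc φ := x.2.choose_spec.choose

theorem HcMinusFun.quotFun_spec (β : CPlus) (x : HcMinusFun φ β) (μ : CPlus) :
    HcMinusFun.quotFun β x μ = ((β : ℂ) + μ)⁻¹ • (x.1 μ + tilde φ μ (HcMinusFun.y β x)) :=
  x.2.choose_spec.choose_spec μ

/-- The map `x ↦ (μ ↦ (x(μ) + φ̃(μ) y_x) / (β + μ))`. -/
def HcMinusFun.quot (β : CPlus) [Cond φ β] : HcMinusFun φ β →ₗ[ℂ] Hc φ where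
  toFun x := HcMinusFun.quotFun β x
  map_add' x x' := HcMinus_unique (HcMinusFun.quotFun_spec β (x + x'))
      (z := HcMinusFun.y β x + HcMinusFun.y β x') fun μ => by
    simp only [RKHS.coe_add, Pi.add_apply, HcMinusFun.quotFun_spec, map_add, ← smul_add,
      Submodule.coe_add]
    congr 1
    abel
  map_smul' c x := HcMinus_unique (HcMinusFun.quotFun_spec β (c • x))
      (z := c • HcMinusFun.y β x) fun μ => by
    simp only [RKHS.coe_smul, Pi.smul_apply, HcMinusFun.quotFun_spec, map_smul, smul_comm c,
      smul_add, RingHom.id_apply, Submodule.coe_smul]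

variable (φ)

/-- The subspace of `HcMinusFun φ β` of the functions of the form `φ̃(·) y` with `y` in `Y`. -/
def HcMinusFun.null (β : CPlus) : Submodule ℂ (HcMinusFun φ β) where
  carrier := {x | ∃ y : Y, ∀ μ : CPlus, x.1 μ = tilde φ μ y}
  zero_mem' := ⟨0, fun _ => by simp⟩
  add_mem' := by
    rintro x y ⟨v, hv⟩ ⟨w, hw⟩
    exact ⟨v + w, fun μ => by simp [hv, hw]⟩
  smul_mem' := by
    rintro c x ⟨v, hv⟩
    exact ⟨c • v, fun μ => by simp [hv]⟩

/-- The space `H_{c,-1}`: the functions `x` such that `μ ↦ (x(μ) + φ̃(μ) y) / (β + μ)` is in `H_c`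
for some `y`, modulo the functions of the form `φ̃(·) y`. -/
def HcMinus (β : CPlus) : Type _ := HcMinusFun φ β ⧸ HcMinusFun.null φ β

instance (β : CPlus) : AddCommGroup (HcMinus φ β) :=
  inferInstanceAs (AddCommGroup (HcMinusFun φ β ⧸ HcMinusFun.null φ β))
instance (β : CPlus) : Module ℂ (HcMinus φ β) :=
  inferInstanceAs (Module ℂ (HcMinusFun φ β ⧸ HcMinusFun.null φ β))

/-- The equivalence class `[x]`. -/
def HcMinus.mk (β : CPlus) : HcMinusFun φ β →ₗ[ℂ] HcMinus φ β := (HcMinusFun.null φ β).mkQ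

/-- The map `[x] ↦ (μ ↦ (x(μ) + φ̃(μ) y_x) / (β + μ))` from `H_{c,-1}` to `H_c`. -/
def HcMinus.quot (β : CPlus) [Cond φ β] : HcMinus φ β →ₗ[ℂ] Hc φ :=
  (HcMinusFun.null φ β).liftQ (HcMinusFun.quot β) fun x ⟨v, hv⟩ => by
    rw [LinearMap.mem_ker]
    refine HcMinus_unique (x := x.1) (z := -v) (HcMinusFun.quotFun_spec β x) fun μ => ?_
    simp [hv]

theorem HcMinus.quot_mk (β : CPlus) [Cond φ β] (x : HcMinusFun φ β) :
    HcMinus.quot φ β (HcMinus.mk φ β x) = HcMinusFun.quot β x := rfl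

theorem HcMinus.quot_injective (β : CPlus) [Cond φ β] :
    Function.Injective (HcMinus.quot φ β) := by
  refine (injective_iff_map_eq_zero _).mpr fun z hz => ?_
  obtain ⟨x, rfl⟩ := Submodule.mkQ_surjective _ z
  refine (Submodule.Quotient.mk_eq_zero _).mpr ⟨-HcMinusFun.y β x, fun μ => ?_⟩
  have h1 : HcMinusFun.quotFun β x = 0 := hz
  have h2 := HcMinusFun.quotFun_spec β x μ
  rw [h1, RKHS.coe_zero, Pi.zero_apply, eq_comm,
    smul_eq_zero_iff_right (inv_ne_zero (CPlus.add_ne β μ))] at h2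
  rw [map_neg]
  exact eq_neg_of_add_eq_zero_left h2

theorem HcMinus.quot_surjective (β : CPlus) [Cond φ β] :
    Function.Surjective (HcMinus.quot φ β) := by
  intro g
  have h1 : ∀ μ : CPlus, g μ = ((β : ℂ) + μ)⁻¹ • (((β : ℂ) + μ) • g μ + tilde φ μ 0) := by
    intro μ
    rw [map_zero, add_zero, smul_smul, inv_mul_cancel₀ (CPlus.add_ne β μ), one_smul]
  have hx : (fun μ : CPlus => ((β : ℂ) + μ) • g μ) ∈ HcMinusFun φ β := ⟨0, g, h1⟩
  refine ⟨HcMinus.mk φ β ⟨_, hx⟩, ?_⟩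
  rw [HcMinus.quot_mk]
  exact HcMinus_unique (x := fun μ : CPlus => ((β : ℂ) + μ) • g μ)
    (HcMinusFun.quotFun_spec β ⟨_, hx⟩) h1

/-- The norm of `[x]` is the norm in `H_c` of `μ ↦ (x(μ) + φ̃(μ) y_x) / (β + μ)`. -/
instance (β : CPlus) [Cond φ β] : NormedAddCommGroup (HcMinus φ β) :=
  NormedAddCommGroup.induced (HcMinus φ β) (Hc φ) (HcMinus.quot φ β)
    (HcMinus.quot_injective φ β)

instance (β : CPlus) [Cond φ β] : InnerProductSpace ℂ (HcMinus φ β) :=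
  InnerProductSpace.induced (HcMinus.quot φ β)

theorem HcMinus.norm_eq (β : CPlus) [Cond φ β] (z : HcMinus φ β) :
    ‖z‖ = ‖HcMinus.quot φ β z‖ := rfl

theorem HcMinus.quot_isometry (β : CPlus) [Cond φ β] : Isometry (HcMinus.quot φ β) :=
  AddMonoidHomClass.isometry_of_norm _ fun x => (HcMinus.norm_eq φ β x).symm

instance (β : CPlus) [Cond φ β] : CompleteSpace (HcMinus φ β) :=
  ((HcMinus.quot_isometry φ β).isUniformInducing.completeSpace_congr
    (HcMinus.quot_surjective φ β)).mpr inferInstance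

/-- The point evaluations `[x] ↦ x(μ) + φ̃(μ) y_x`, written as `β + μ` times the value at `μ` of
`(x + φ̃ y_x) / (β + ·)`; see `HcMinus.eval_mk`. -/
def HcMinus.eval (β : CPlus) [Cond φ β] : HcMinus φ β →L[ℂ] CPlus → U where
  toFun z μ := ((β : ℂ) + μ) • HcMinus.quot φ β z μ
  map_add' z w := by ext μ; simp
  map_smul' c z := by ext μ; simp [smul_comm c]
  cont := continuous_pi fun μ =>
    ((RKHS.continuous_eval μ).comp (HcMinus.quot_isometry φ β).continuous).const_smul _

theorem HcMinus.eval_mk (β : CPlus) [Cond φ β] (x : HcMinusFun φ β) (μ : CPlus) :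
    HcMinus.eval φ β (HcMinus.mk φ β x) μ = x.1 μ + tilde φ μ (HcMinusFun.y β x) := by
  show ((β : ℂ) + μ) • HcMinusFun.quotFun β x μ = _
  rw [HcMinusFun.quotFun_spec, smul_smul, mul_inv_cancel₀ (CPlus.add_ne β μ), one_smul]

/-- `H_{c,-1}` as a reproducing kernel Hilbert space, with the point evaluations
`[x] ↦ x(μ) + φ̃(μ) y_x`. -/
instance (β : CPlus) [Cond φ β] : RKHS ℂ (HcMinus φ β) CPlus U where
  coeCLM := HcMinus.eval φ β
  coeCLM_injective := by
    intro z w h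
    refine HcMinus.quot_injective φ β (RKHS.ext fun μ => ?_)
    exact smul_right_injective U (CPlus.add_ne β μ) (congrFun h μ)

end HcMinus

end rigged

end

end DBR

open DBR
open scoped ComplexConjugate

/-!
Every kernel in the theorem is the kernel `K_c` seen through a resolvent of the main operator
`A = A_c` or of its adjoint, so the proof consists in computing these resolvents on functions.

The identity `B_c u = (λ - A|_{H_c}) e_c(λ̄)^* u`, valid for every `λ` because the generators of the
graph of `S_c` lie in that graph, gives at once `(λ̄ - A|_{H_c})⁻¹ B_c u = e_c(λ)^* u` (`resB_conj`)
and, by duality, `B_c^* (μ - A^*)⁻¹ x = x(μ)` (`BcDual_resDom`). Thus `B_c^* (μ - A^*)⁻¹` is point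
evaluation and `(λ̄ - A|_{H_c})⁻¹ B_c` is its adjoint, and each state-space formula reduces to the
identification of the element of the space that represents point evaluation.

The spaces `H_{c,1}`, `H^d_{c,1}`, `H^d_{c,-1}`, `H_{c,-1}` carry the norm that makes a certain map
onto `H_c` unitary: `β - A`, `β̄ - A^*`, and the two quotient maps. Transporting point evaluation
along this map gives the kernels, with `((β - A)⁻¹)^* = (β̄ - A^*)⁻¹` in the first two cases.

On functions, the resolvents act by
* `((β̄ - A^*)⁻¹ x)(μ) = (x(μ) - x(β̄)) / (β̄ - μ)` (`resOp_adjoint_apply`), since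
  `((μ - A^*) z)(μ) = B_c^* z` does not depend on `μ`;
* `((β - A)⁻¹ x)(μ) = (x(μ) - φ̃(μ) τ x) / (β + μ)` (`resOp_apply_eq`), from the polarized energy
  balance of `S_c` between `((z, 0), (A z, C z))` and a generator.

These are exactly the quotient maps that define `H^d_{c,-1}` and `H_{c,-1}`, which is why these
spaces are the completions in question. The second formula also shows that the extra condition at
one point implies it at every other (`Cond.of_cond`).
-/

namespace DBR

open Complex ComplexConjugate
open scoped InnerProductSpace

noncomputable section

/-! ### Resolvents, adjoints and the extrapolation space -/

section resolvent

variable {X : Type*} [NormedAddCommGroup X] [InnerProductSpace ℂ X] (A : X →ₗ.[ℂ] X)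

theorem denseRange_resOp (hA : Dense (A.domain : Set X)) (α : ℂ) [InResolventSet A α] :
    DenseRange (resOp A α) := by
  refine hA.mono fun x hx => ⟨shift A α ⟨x, hx⟩, ?_⟩
  rw [resOp_apply, resDom_shift]

variable [CompleteSpace X]

theorem adjoint_resOp (hA : Dense (A.domain : Set X)) (α : ℂ) [InResolventSet A α]
    [InResolventSet A.adjoint (conj α)] :
    ContinuousLinearMap.adjoint (resOp A α) = resOp A.adjoint (conj α) := by
  refine (ContinuousLinearMap.eq_adjoint_iff _ _).mpr (fun w x => ?_) |>.symm
  have h := shift_adjoint_inner A hA α (resDom A.adjoint (conj α) w) (resDom A α x)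
  rw [shift_resDom, shift_resDom] at h
  rw [resOp_apply, resOp_apply, h]

/-- The range of `(ᾱ - A^*)⁻¹` is dense, because its adjoint `(α - A)⁻¹` is injective. -/
theorem denseRange_resOp_adjoint (hA : Dense (A.domain : Set X)) (α : ℂ) [InResolventSet A α]
    [InResolventSet A.adjoint (conj α)] : DenseRange (resOp A.adjoint (conj α)) := by
  have h := ContinuousLinearMap.orthogonal_range (resOp A.adjoint (conj α))
  rw [← adjoint_resOp A hA α, ContinuousLinearMap.adjoint_adjoint,
    LinearMap.ker_eq_bot.mpr (resOp_injective A α), adjoint_resOp A hA α,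
    ← Submodule.topologicalClosure_eq_top_iff, ← Submodule.dense_iff_topologicalClosure_eq_top] at h
  exact h

/-- The extended resolvent `(β - A)⁻¹ : X₋₁ → X` as a unitary operator. It is isometric by the
definition of the norm of `X₋₁`, hence onto as soon as its range is dense. -/
def Ext.resEquiv (β : ℂ) [InResolventSet A β] (hd : DenseRange (resOp A β)) :
    Ext A β ≃ₗᵢ[ℂ] X :=
  have hiso : ∀ w, ‖Ext.res A β w‖ = ‖w‖ := fun w =>
    congrFun ((Ext.denseRange_emb A β).equalizer (g := fun w => ‖Ext.res A β w‖)
      (h := fun w => ‖w‖) (by fun_prop) continuous_norm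
      (by ext x; simp [Ext.norm_emb])) w
  LinearIsometryEquiv.ofSurjective ⟨(Ext.res A β).toLinearMap, hiso⟩ <| by
    have h1 : Isometry (Ext.res A β) := AddMonoidHomClass.isometry_of_norm _ hiso
    have h2 : DenseRange (Ext.res A β) := hd.mono <| by
      rintro _ ⟨x, rfl⟩
      exact ⟨Ext.emb A β x, Ext.res_emb A β x⟩
    exact Set.range_eq_univ.mp (h1.isClosedEmbedding.isClosed_range.closure_eq ▸ h2.closure_range)

theorem Ext.resEquiv_emb (β : ℂ) [InResolventSet A β] (hd : DenseRange (resOp A β)) (x : X) :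
    Ext.resEquiv A β hd (Ext.emb A β x) = resOp A β x := Ext.res_emb A β x

/-- The pairing of `X₋₁` with the domain of `A^*` does not depend on the reference point: on the
range of `α - A|_X` it can be computed with `ᾱ - A^*`. -/
theorem pairing_shift (hA : Dense (A.domain : Set X)) (β α : ℂ) [InResolventSet A β] (x : X)
    (z : A.adjoint.domain) :
    pairing A β (Ext.shift A β α x) z = ⟪shift A.adjoint (conj α) z, x⟫_ℂ := by
  have hs : Ext.shift A β α x = Ext.shift A β β x + (α - β) • Ext.emb A β x := by
    simp only [Ext.shift, sub_apply, smul_apply]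
    module
  have hp : pairing A β (Ext.shift A β α x) z = pairing A β (Ext.shift A β β x) z +
      (α - β) * pairing A β (Ext.emb A β x) z := by
    simp only [pairing, hs, map_add, map_smul, inner_add_right, inner_smul_right]
  rw [hp, pairing_emb A β hA, pairing, Ext.res_shift A β hA, shift_apply, shift_apply,
    inner_sub_left, inner_sub_left, inner_smul_left, inner_smul_left, conj_conj, conj_conj]
  ring

end resolvent

variable {U Y : Type*} [NormedAddCommGroup U] [InnerProductSpace ℂ U] [CompleteSpace U]
  [NormedAddCommGroup Y] [InnerProductSpace ℂ Y] [CompleteSpace Y] (φ : SchurFunction U Y)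

/-! ### The control operator and point evaluation -/

/-- `B_c u = (λ - A_c|_{H_c}) e_c(λ̄)^* u` for every `λ`, not only for the reference point `β`. -/
theorem Bc_eq_shift (β l : CPlus) (u : U) :
    Bc φ β u = Ext.shift (Ac φ) β l (ec φ l.conj u) := by
  have h := gen_mem φ l u
  rw [← node_graph, LinearPMap.mem_graph_iff] at h
  obtain ⟨q, hq1, hq2⟩ := h
  have h := Bc_spec φ β q
  rw [hq1, hq2, map_smul] at h
  simp only at h
  simp only [Ext.shift, sub_apply, smul_apply, h, add_sub_cancel_left]

/-- `(λ̄ - A_c|_{H_c})⁻¹ B_c` is the adjoint of the evaluation at `λ`. -/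
theorem resB_conj (β l : CPlus) (u : U) : resB φ β l.conj u = ec φ l u := by
  obtain ⟨e, he⟩ := Ext.shift_isInvertible (Ac φ) β (Ac_dense φ) l.conj
  have h := shift_resB φ β l.conj u
  rw [Bc_eq_shift φ β l.conj u, CPlus.conj_conj, ← he] at h
  exact e.injective h

/-- `B_c^*` evaluates `(μ - A_c^*) z` at `μ`, for every `μ`. -/
theorem BcDual_eq (β μ : CPlus) (z : (Ac φ).adjoint.domain) :
    BcDual φ β z = (shift (Ac φ).adjoint μ z : Hc φ) μ := by
  refine ext_inner_right ℂ fun u => ?_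
  rw [BcDual, dualMap_inner, Bc_eq_shift φ β μ.conj u, pairing_shift _ (Ac_dense φ),
    CPlus.conj_conj, RKHS.inner_kerFun, CPlus.coe_conj, conj_conj]

/-- `B_c^* (μ - A_c^*)⁻¹` is the evaluation at `μ`. -/
theorem BcDual_resDom (β μ : CPlus) (x : Hc φ) :
    BcDual φ β (resDom (Ac φ).adjoint μ x) = x μ := by
  rw [BcDual_eq φ β μ, shift_resDom]

/-! ### The resolvents as operators on functions -/

/-- `(β̄ - A_c^*)⁻¹` is the difference quotient at `β̄`. -/
theorem resOp_adjoint_apply (β μ : CPlus) (x : Hc φ) :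
    (conj (β : ℂ) - μ) • resOp (Ac φ).adjoint β.conj x μ = x μ - x β.conj := by
  -- Both sides of `((μ - A^*) z)(μ) = ((β̄ - A^*) z)(β̄)` equal `B^* z`.
  set z := resDom (Ac φ).adjoint β.conj x with hz
  have h1 : (shift (Ac φ).adjoint μ z : Hc φ) μ = x β.conj := by
    rw [← BcDual_eq φ β μ z, BcDual_eq φ β β.conj z, shift_resDom]
  have h2 : shift (Ac φ).adjoint μ z = x - (conj (β : ℂ) - μ) • (z : Hc φ) := by
    rw [← shift_resDom (Ac φ).adjoint β.conj x, ← hz, shift_apply, shift_apply, CPlus.coe_conj]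
    module
  rw [h2, RKHS.coe_sub, RKHS.coe_smul, Pi.sub_apply, Pi.smul_apply] at h1
  rw [resOp_apply, ← h1, ← hz]
  abel

/-- The action of `(β - A_c)⁻¹` on functions; it comes from the energy balance between the graph of
`S_c` over `dom A_c` and the generators of that graph. -/
theorem resOp_apply_eq (β μ : CPlus) (x : Hc φ) :
    ((β : ℂ) + μ) • resOp (Ac φ) β x μ = x μ - tilde φ μ (tau φ β x) := by
  set d := resDom (Ac φ) β x with hd
  have hA : Ac φ d = (β : ℂ) • (d : Hc φ) - x := by
    rw [← shift_resDom (Ac φ) β x, ← hd, shift_apply]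
    abel
  refine ext_inner_right ℂ fun v => ?_
  have h := energy_eq_zero φ (Ac_mem φ d) (gen_mem φ μ.conj v)
  rw [energy_apply, hA] at h
  simp only [CPlus.conj_conj, CPlus.coe_conj, inner_zero_left, inner_smul_right,
    RKHS.inner_kerFun, RKHS.coe_sub, RKHS.coe_smul, Pi.sub_apply, Pi.smul_apply, inner_sub_left,
    inner_smul_left] at h
  have ht : ⟪tilde φ μ (tau φ β x), v⟫_ℂ = ⟪Cc φ d, φ.toFun μ.conj v⟫_ℂ :=
    ContinuousLinearMap.adjoint_inner_left _ _ _
  rw [CPlus.coe_conj] at ht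
  rw [resOp_apply, ← hd, inner_smul_left, inner_sub_left, ht, map_add]
  linear_combination -h

/-- The difference of two generators of the graph of `S_c` with the same `u` lies over `dom A_c`,
which gives `(β - A_c)⁻¹` on the kernel functions. -/
theorem resOp_ec (β l : CPlus) (u : U) :
    (β - conj (l : ℂ)) • resOp (Ac φ) β (ec φ l u) = ec φ l u - ec φ β.conj u := by
  have hm := (nodeGraph φ).sub_mem (gen_mem φ l.conj u) (gen_mem φ β u)
  rw [CPlus.conj_conj, CPlus.coe_conj] at hm
  obtain ⟨d, hd1, hd2, -⟩ := exists_Ac φ (x := ec φ l u - ec φ β.conj u)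
    (z := conj (l : ℂ) • ec φ l u - (β : ℂ) • ec φ β.conj u)
    (y := φ.toFun l.conj u - φ.toFun β u) (by convert hm using 1; simp)
  have h : shift (Ac φ) β d = (β - conj (l : ℂ)) • ec φ l u := by
    rw [shift_apply, hd1, hd2]
    module
  rw [← map_smul, ← h, resOp_apply, resDom_shift, hd1]

theorem adjoint_resOp_Ac (β : CPlus) :
    ContinuousLinearMap.adjoint (resOp (Ac φ) β) = resOp (Ac φ).adjoint β.conj :=
  have : InResolventSet (Ac φ).adjoint (conj (β : ℂ)) := Ac_adjoint_resolvent φ β.conj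
  adjoint_resOp (Ac φ) (Ac_dense φ) β

/-! ### The reproducing kernels -/

theorem kernel_HcdOne_eq (β μ l : CPlus) (u : U) : RKHS.kernel (HcdOne φ β) μ l u =
    resOp (Ac φ).adjoint β.conj (resOp (Ac φ) β (ec φ l u)) μ := by
  -- `⟪(β̄ - A^*) k, w⟫ = ⟪u, ((β̄ - A^*)⁻¹ w)(l)⟫` determines the representing element `k`.
  have h : RigOne.shift _ _ (RKHS.kerFun (HcdOne φ β) l u) = resOp (Ac φ) β (ec φ l u) := by
    refine ext_inner_right ℂ fun w => ?_
    set f : HcdOne φ β := resDom (Ac φ).adjoint β.conj w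
    have hf : RigOne.shift _ _ f = w := shift_resDom _ _ _
    have h1 : ⟪RigOne.shift _ _ (RKHS.kerFun (HcdOne φ β) l u), RigOne.shift _ _ f⟫_ℂ =
      ⟪u, f l⟫_ℂ := RKHS.kerFun_inner l u f
    have h2 : f l = resOp (Ac φ).adjoint β.conj w l := rfl
    rw [hf, h2, ← RKHS.kerFun_inner, ← adjoint_resOp_Ac,
      ContinuousLinearMap.adjoint_inner_right] at h1
    exact h1
  rw [← RKHS.kerFun_apply, ← h, resOp_apply]
  exact congrArg (fun d : (Ac φ).adjoint.domain => (d : Hc φ) μ) (resDom_shift _ _ _).symm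

theorem kernel_HcOne_eq (β μ l : CPlus) (u : U) : RKHS.kernel (HcOne φ β) μ l u =
    resOp (Ac φ) β (resOp (Ac φ).adjoint β.conj (ec φ l u)) μ := by
  -- `⟪(β - A) k, w⟫ = ⟪u, ((β - A)⁻¹ w)(l)⟫` determines the representing element `k`.
  have h : RigOne.shift _ _ (RKHS.kerFun (HcOne φ β) l u) =
      resOp (Ac φ).adjoint β.conj (ec φ l u) := by
    refine ext_inner_right ℂ fun w => ?_
    set f : HcOne φ β := resDom (Ac φ) β w
    have hf : RigOne.shift _ _ f = w := shift_resDom _ _ _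
    have h1 : ⟪RigOne.shift _ _ (RKHS.kerFun (HcOne φ β) l u), RigOne.shift _ _ f⟫_ℂ =
      ⟪u, f l⟫_ℂ := RKHS.kerFun_inner l u f
    have h2 : f l = resOp (Ac φ) β w l := rfl
    rw [hf, h2, ← RKHS.kerFun_inner, ← ContinuousLinearMap.adjoint_inner_left,
      adjoint_resOp_Ac] at h1
    exact h1
  rw [← RKHS.kerFun_apply, ← h, resOp_apply]
  exact congrArg (fun d : (Ac φ).domain => (d : Hc φ) μ) (resDom_shift _ _ _).symm

theorem kernel_HcdMinus_eq (β μ l : CPlus) : RKHS.kernel (HcdMinus φ β) μ l =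
    ((conj (β : ℂ) - μ) * (β - conj (l : ℂ))) • Kc φ μ l := by
  ext u
  have h : HcdMinus.quot φ β (RKHS.kerFun (HcdMinus φ β) l u) =
      (β - conj (l : ℂ)) • ec φ l u := by
    refine ext_inner_right ℂ fun w => ?_
    obtain ⟨f, rfl⟩ := HcdMinus.quot_surjective φ β w
    have h1 : ⟪HcdMinus.quot φ β (RKHS.kerFun (HcdMinus φ β) l u), HcdMinus.quot φ β f⟫_ℂ =
      ⟪u, f l⟫_ℂ := RKHS.kerFun_inner l u f
    have h2 : f l = (conj (β : ℂ) - l) • HcdMinus.quot φ β f l := HcdMinus.eval_eq φ β f l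
    rw [h1, h2, inner_smul_left, inner_smul_right, RKHS.kerFun_inner, map_sub, conj_conj]
  have h3 : RKHS.kerFun (HcdMinus φ β) l u μ = _ := HcdMinus.eval_eq φ β _ μ
  rw [← RKHS.kerFun_apply, h3, h, RKHS.coe_smul, Pi.smul_apply, ec_apply, smul_smul]
  rfl

theorem kernel_HcMinus_eq (β μ l : CPlus) [Cond φ β] : RKHS.kernel (HcMinus φ β) μ l =
    (((β : ℂ) + μ) * (conj (β : ℂ) + conj (l : ℂ))) • Kc φ μ l := by
  ext u
  have h : HcMinus.quot φ β (RKHS.kerFun (HcMinus φ β) l u) =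
      (conj (β : ℂ) + conj (l : ℂ)) • ec φ l u := by
    refine ext_inner_right ℂ fun w => ?_
    obtain ⟨f, rfl⟩ := HcMinus.quot_surjective φ β w
    have h1 : ⟪HcMinus.quot φ β (RKHS.kerFun (HcMinus φ β) l u), HcMinus.quot φ β f⟫_ℂ =
      ⟪u, f l⟫_ℂ := RKHS.kerFun_inner l u f
    have h2 : f l = ((β : ℂ) + l) • HcMinus.quot φ β f l := rfl
    rw [h1, h2, inner_smul_left, inner_smul_right, RKHS.kerFun_inner, map_add, conj_conj, conj_conj]
  have h3 : RKHS.kerFun (HcMinus φ β) l u μ =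
    ((β : ℂ) + μ) • HcMinus.quot φ β (RKHS.kerFun (HcMinus φ β) l u) μ := rfl
  rw [← RKHS.kerFun_apply, h3, h, RKHS.coe_smul, Pi.smul_apply, ec_apply, smul_smul]
  rfl

theorem CPlus.sub_ne {μ b : CPlus} (h : μ ≠ b) : (b : ℂ) - μ ≠ 0 :=
  fun h0 => h (Subtype.ext (sub_eq_zero.mp h0).symm)

theorem kernel_HcdOne_quotient (β : CPlus) {μ l : CPlus} (hμ : μ ≠ β.conj) (hl : l ≠ β.conj) :
    RKHS.kernel (HcdOne φ β) μ l =
      ((conj (β : ℂ) - μ) * (β - conj (l : ℂ)))⁻¹ • (Kc φ μ l - Kc φ μ β.conj) -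
        ((conj (β : ℂ) - μ) * (β - conj (l : ℂ)))⁻¹ •
          (Kc φ β.conj l - Kc φ β.conj β.conj) := by
  have h1 : conj (β : ℂ) - μ ≠ 0 := CPlus.sub_ne hμ
  have h2 : (β : ℂ) - conj (l : ℂ) ≠ 0 := by
    intro h
    apply CPlus.sub_ne hl
    simpa using congrArg conj h
  ext u
  have h3 := resOp_adjoint_apply φ β μ ((β - conj (l : ℂ)) • resOp (Ac φ) β (ec φ l u))
  rw [map_smul, RKHS.coe_smul, Pi.smul_apply, smul_smul, resOp_ec,
    ← kernel_HcdOne_eq] at h3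
  rw [← smul_sub, smul_apply, eq_inv_smul_iff₀ (mul_ne_zero h1 h2), h3]
  simp only [RKHS.coe_sub, Pi.sub_apply, ec_apply, sub_apply]

/-! ### Norm-continuity of the kernels -/

theorem continuous_Kc : Continuous fun p : CPlus × CPlus => Kc φ p.1 p.2 := by
  have h1 : Continuous fun m : CPlus => φ.toFun m.conj :=
    φ.holomorphic.continuousOn.comp_continuous
      (continuous_conj.comp continuous_subtype_val) fun m => m.conj.2
  have h2 : Continuous fun m : CPlus => ContinuousLinearMap.adjoint (φ.toFun m.conj) :=
    ContinuousLinearMap.adjoint.continuous.comp h1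
  refine Continuous.smul (Continuous.inv₀ ?_ fun p => CPlus.add_ne p.1 p.2.conj)
    (continuous_const.sub ((h2.comp continuous_fst).clm_comp (h1.comp continuous_snd)))
  exact (continuous_subtype_val.comp continuous_fst).add
    (continuous_conj.comp (continuous_subtype_val.comp continuous_snd))

/-- The point evaluations depend on the point norm-continuously, because
`‖e(m)^* - e(l)^*‖² = ‖K(m,m) - K(m,l) - K(l,m) + K(l,l)‖`. -/
theorem continuous_ec : Continuous (ec φ) := by
  rw [continuous_iff_continuousAt]
  intro l
  have h1 : ∀ m, ‖ec φ m - ec φ l‖ ^ 2 =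
      ‖Kc φ m m - Kc φ m l - (Kc φ l m - Kc φ l l)‖ := by
    intro m
    rw [sq, ← ContinuousLinearMap.norm_adjoint_comp_self, ← kernel_Hc]
    simp only [RKHS.kernel_apply, map_sub, ContinuousLinearMap.sub_comp,
      ContinuousLinearMap.comp_sub]
    congr 1
    abel
  have hK := continuous_Kc φ
  have h2 : Continuous fun m : CPlus => ‖ec φ m - ec φ l‖ ^ 2 := by
    simp only [h1]
    have a : Continuous fun m : CPlus => Kc φ m m := hK.comp (continuous_id.prodMk continuous_id)
    have b : Continuous fun m : CPlus => Kc φ m l := hK.comp (continuous_id.prodMk continuous_const)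
    have c : Continuous fun m : CPlus => Kc φ l m := hK.comp (continuous_const.prodMk continuous_id)
    exact ((a.sub b).sub (c.sub continuous_const)).norm
  rw [ContinuousAt, tendsto_iff_norm_sub_tendsto_zero]
  simpa using (h2.tendsto l).sqrt

theorem continuous_kernel_HcdOne (β : CPlus) :
    Continuous fun p : CPlus × CPlus => RKHS.kernel (HcdOne φ β) p.1 p.2 := by
  have h : ∀ p : CPlus × CPlus, RKHS.kernel (HcdOne φ β) p.1 p.2 =
      ContinuousLinearMap.adjoint (ec φ p.1) ∘L
        (resOp (Ac φ).adjoint β.conj ∘L resOp (Ac φ) β) ∘L ec φ p.2 := by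
    intro p
    ext u
    rw [kernel_HcdOne_eq]
    exact (RKHS.adjoint_kerFun (H := Hc φ) p.1 _).symm
  simp only [h]
  exact (ContinuousLinearMap.adjoint.continuous.comp
    ((continuous_ec φ).comp continuous_fst)).clm_comp
    (continuous_const.clm_comp ((continuous_ec φ).comp continuous_snd))

/-! ### The completions -/

/-- `H^d_{c,-1}` is the completion of `H_c` in the norm `‖(β̄ - A_c^*)⁻¹ x‖`. -/
theorem exists_equiv_HcdMinus (β : CPlus) :
    ∃ J : Ext (Ac φ).adjoint β.conj ≃ₗᵢ[ℂ] HcdMinus φ β, ∀ x : Hc φ,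
      ∃ hx : ⇑x ∈ HcdMinusFun φ β, J (Ext.emb (Ac φ).adjoint β.conj x) =
        HcdMinus.mk φ β ⟨⇑x, hx⟩ := by
  let Q : HcdMinus φ β ≃ₗᵢ[ℂ] Hc φ :=
    .ofSurjective ⟨HcdMinus.quot φ β, fun x => (HcdMinus.norm_eq φ β x).symm⟩
      (HcdMinus.quot_surjective φ β)
  have hd : DenseRange (resOp (Ac φ).adjoint β.conj) :=
    have : InResolventSet (Ac φ).adjoint (conj (β : ℂ)) := Ac_adjoint_resolvent φ β.conj
    denseRange_resOp_adjoint (Ac φ) (Ac_dense φ) β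
  refine ⟨(Ext.resEquiv _ _ hd).trans Q.symm, fun x => ?_⟩
  have hx : ⇑x ∈ HcdMinusFun φ β := ⟨_, fun μ => resOp_adjoint_apply φ β μ x⟩
  refine ⟨hx, ?_⟩
  rw [LinearIsometryEquiv.trans_apply, Ext.resEquiv_emb, LinearIsometryEquiv.symm_apply_eq]
  exact HcdMinus_unique (x := ⇑x) (fun μ => resOp_adjoint_apply φ β μ x)
    (HcdMinusFun.quot_spec β ⟨⇑x, hx⟩)

/-- The condition at one point `α` implies it at every point `β`. -/
theorem Cond.of_cond {α : CPlus} (h : Cond φ α) (β : CPlus) : Cond φ β := by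
  refine ⟨fun y g hg => ?_⟩
  -- `(β + ·) g` is of the form `φ̃ y`, and `g + (β - α) (α - A)⁻¹ g` is `((β + ·) / (α + ·)) g` minus
  -- a function `φ̃ y' / (α + ·)`, so the condition at `α` annihilates it; the sum is also
  -- `(β - A) (α - A)⁻¹ g`.
  have h0 : g + ((β : ℂ) - α) • resOp (Ac φ) α g = 0 := by
    refine h.eq_zero (y - ((β : ℂ) - α) • tau φ α g) _ fun μ => ?_
    rw [eq_inv_smul_iff₀ (CPlus.add_ne α μ), RKHS.coe_add, RKHS.coe_smul, Pi.add_apply,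
      Pi.smul_apply, smul_add, smul_comm _ ((β : ℂ) - α), resOp_apply_eq, map_sub, map_smul]
    have h1 : tilde φ μ y = ((β : ℂ) + μ) • g μ :=
      ((eq_inv_smul_iff₀ (CPlus.add_ne β μ)).mp (hg μ)).symm
    rw [h1]
    module
  set x := resDom (Ac φ) α g with hx
  have h1 : shift (Ac φ) β x = 0 := by
    have h2 : shift (Ac φ) α x = g := shift_resDom _ _ _
    rw [← h0, resOp_apply, ← hx, ← h2, shift_apply, shift_apply]
    module
  have h2 : x = 0 := by rw [← resDom_shift (Ac φ) β x, h1, map_zero]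
  rw [← shift_resDom (Ac φ) α g, ← hx, h2, map_zero]

/-- `H_{c,-1}` is the completion of `H_c` in the norm `‖(β - A_c)⁻¹ x‖`; here `y_x` is
`-C_c (β - A_c)⁻¹ x`. -/
theorem exists_equiv_HcMinus (β : CPlus) [Cond φ β] :
    ∃ J : Ext (Ac φ) β ≃ₗᵢ[ℂ] HcMinus φ β, ∀ x : Hc φ,
      ∃ hx : ⇑x ∈ HcMinusFun φ β, J (Ext.emb (Ac φ) β x) = HcMinus.mk φ β ⟨⇑x, hx⟩ := by
  let Q : HcMinus φ β ≃ₗᵢ[ℂ] Hc φ :=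
    .ofSurjective ⟨HcMinus.quot φ β, fun x => (HcMinus.norm_eq φ β x).symm⟩
      (HcMinus.quot_surjective φ β)
  refine ⟨(Ext.resEquiv _ _ (denseRange_resOp (Ac φ) (Ac_dense φ) β)).trans Q.symm, fun x => ?_⟩
  have h1 : ∀ μ : CPlus, resOp (Ac φ) β x μ =
      ((β : ℂ) + μ)⁻¹ • (x μ + tilde φ μ (-tau φ β x)) := by
    intro μ
    rw [eq_inv_smul_iff₀ (CPlus.add_ne β μ), resOp_apply_eq, map_neg, sub_eq_add_neg]
  have hx : ⇑x ∈ HcMinusFun φ β := ⟨_, _, h1⟩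
  refine ⟨hx, ?_⟩
  rw [LinearIsometryEquiv.trans_apply, Ext.resEquiv_emb, LinearIsometryEquiv.symm_apply_eq]
  exact HcMinus_unique (x := ⇑x) h1 (HcMinusFun.quotFun_spec β ⟨⇑x, hx⟩)

end

end DBR

theorem proposition4p15 {U Y : Type*}
    [NormedAddCommGroup U] [InnerProductSpace ℂ U] [CompleteSpace U]
    [NormedAddCommGroup Y] [InnerProductSpace ℂ Y] [CompleteSpace Y]
    (φ : SchurFunction U Y) (β : CPlus) :
    -- the state-space formulas that need no extra condition
    (∀ (μ l : CPlus) (u : U),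
      RKHS.kernel (Hc φ) μ l u =
        BcDual φ β (resDom (Ac φ).adjoint μ (resB φ β l.conj u)) ∧
      RKHS.kernel (HcdOne φ β) μ l u =
        BcDual φ β (resDom (Ac φ).adjoint μ (resOp (Ac φ).adjoint β.conj
          (resOp (Ac φ) β (resB φ β l.conj u)))) ∧
      RKHS.kernel (HcdMinus φ β) μ l u =
        ((conj (β : ℂ) - μ) * (β - conj (l : ℂ))) •
          BcDual φ β (resDom (Ac φ).adjoint μ (resB φ β l.conj u)) ∧
      RKHS.kernel (HcOne φ β) μ l u =
        BcDual φ β (resDom (Ac φ).adjoint μ (resOp (Ac φ) β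
          (resOp (Ac φ).adjoint β.conj (resB φ β l.conj u))))) ∧
    -- the function-theoretic formulas that need no extra condition
    (∀ μ l : CPlus, RKHS.kernel (Hc φ) μ l =
      ((μ : ℂ) + conj (l : ℂ))⁻¹ •
        (1 - ContinuousLinearMap.adjoint (φ.toFun μ.conj) ∘L φ.toFun l.conj)) ∧
    (∀ μ l : CPlus, μ ≠ β.conj → l ≠ β.conj → RKHS.kernel (HcdOne φ β) μ l =
      ((conj (β : ℂ) - μ) * (β - conj (l : ℂ)))⁻¹ • (Kc φ μ l - Kc φ μ β.conj) -
        ((conj (β : ℂ) - μ) * (β - conj (l : ℂ)))⁻¹ •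
          (Kc φ β.conj l - Kc φ β.conj β.conj)) ∧
    (Continuous fun p : CPlus × CPlus => RKHS.kernel (HcdOne φ β) p.1 p.2) ∧
    (∀ μ l : CPlus, RKHS.kernel (HcdMinus φ β) μ l =
      ((conj (β : ℂ) - μ) * (β - conj (l : ℂ))) • Kc φ μ l) ∧
    (∀ (l : CPlus) (u : U), ∃ κ : Hc φ,
      (∀ μ : CPlus, μ ≠ β.conj →
        κ μ = (conj (β : ℂ) - μ)⁻¹ • (Kc φ μ l u - Kc φ β.conj l u)) ∧
      ∀ μ : CPlus, RKHS.kernel (HcOne φ β) μ l u =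
        ((β : ℂ) + μ)⁻¹ •
          (κ μ - ContinuousLinearMap.adjoint (φ.toFun μ.conj) (tau φ β κ))) ∧
    -- the space `HcdMinus` is the completion of `Hc` in the norm of the rigging of the adjoint
    (∃ J : Ext (Ac φ).adjoint β.conj ≃ₗᵢ[ℂ] HcdMinus φ β, ∀ x : Hc φ,
      ∃ hx : ⇑x ∈ HcdMinusFun φ β, J (Ext.emb (Ac φ).adjoint β.conj x) =
        HcdMinus.mk φ β ⟨⇑x, hx⟩) ∧
    -- the space `HcMinus` and its kernel, under the extra condition
    ((∃ α : CPlus, Cond φ α) → ∃ _ : Cond φ β,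
      (∃ J : Ext (Ac φ) β ≃ₗᵢ[ℂ] HcMinus φ β, ∀ x : Hc φ,
        ∃ hx : ⇑x ∈ HcMinusFun φ β, J (Ext.emb (Ac φ) β x) = HcMinus.mk φ β ⟨⇑x, hx⟩) ∧
      (∀ (μ l : CPlus) (u : U), RKHS.kernel (HcMinus φ β) μ l u =
        (((β : ℂ) + μ) * (conj (β : ℂ) + conj (l : ℂ))) •
          BcDual φ β (resDom (Ac φ).adjoint μ (resB φ β l.conj u))) ∧
      ∀ μ l : CPlus, RKHS.kernel (HcMinus φ β) μ l =
        (((β : ℂ) + μ) * (conj (β : ℂ) + conj (l : ℂ))) • Kc φ μ l) := by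
  have hKc : ∀ (μ l : CPlus) (u : U),
      BcDual φ β (resDom (Ac φ).adjoint μ (resB φ β l.conj u)) = Kc φ μ l u := fun μ l u => by
    rw [BcDual_resDom, resB_conj, ec_apply]
  refine ⟨fun μ l u => ⟨?_, ?_, ?_, ?_⟩, fun μ l => ?_, fun μ l hμ hl =>
    kernel_HcdOne_quotient φ β hμ hl, continuous_kernel_HcdOne φ β, kernel_HcdMinus_eq φ β,
    fun l u => ?_, exists_equiv_HcdMinus φ β, ?_⟩
  · rw [hKc, kernel_Hc]
  · rw [BcDual_resDom, resB_conj, kernel_HcdOne_eq]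
  · rw [hKc, kernel_HcdMinus_eq]
    rfl
  · rw [BcDual_resDom, resB_conj, kernel_HcOne_eq]
  · rw [kernel_Hc]
    rfl
  · refine ⟨resOp (Ac φ).adjoint β.conj (ec φ l u), fun μ hμ => ?_, fun μ => ?_⟩
    · have h : conj (β : ℂ) - μ ≠ 0 := CPlus.sub_ne hμ
      rw [eq_inv_smul_iff₀ h, resOp_adjoint_apply, ec_apply,
        ec_apply]
    · rw [kernel_HcOne_eq, eq_inv_smul_iff₀ (CPlus.add_ne β μ), resOp_apply_eq]
      rfl
  · rintro ⟨α, hα⟩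
    have hβ := Cond.of_cond φ hα β
    refine ⟨hβ, exists_equiv_HcMinus φ β, fun μ l u => ?_, fun μ l => kernel_HcMinus_eq φ β μ l⟩
    rw [hKc, kernel_HcMinus_eq]
    rfl
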